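/- Let $n\ge 0$ be an integer and let $Z\subset\mathbb{R}^n$ be an $n$-dimensional lattice zonotope, that is, $Z=\sum_{k=1}^m[p_k,p_k+v_k]$ is a Minkowski sum of finitely many segments with $p_k,v_k\in\mathbb{Z}^n$, and the affine hull of $Z$ is $\mathbb{R}^n$. Write $DZ=Z-Z$, let $\mathrm{vol}$ denote Lebesgue measure on $\mathbb{R}^n$, and for $1\le j\le n$ let $$\lambda_j=\lambda_j(DZ)=\min\{\lambda>0:\dim(\lambda\,DZ\cap\mathbb{Z}^n)\ge j\}$$ be the successive minima of $DZ$ with respect to $\mathbb{Z}^n$, where $\dim$ is the dimension of the affine hull. For $0\le i\le n$ put $$\sigma_i(Z)=\sum_{I\subseteq\{1,\dots,n\},\ \#I=i}\ \prod_{j\in I}\frac1{\lambda_j}.$$ Then there are (unique) real numbers $\mathrm{g}_0(Z),\dots,\mathrm{g}_n(Z)$, the Ehrhart coefficients of $Z$, with $$\#(kZ\cap\mathbb{Z}^n)=\sum_{i=0}^n \mathrm{g}_i(Z)\,k^i\qquad\text{for all } k\in\{0,1,2,\dots\},$$ and for every $i=0,\dots,n$ $$\frac{\mathrm{g}_i(Z)}{\mathrm{vol}(Z)}\le\frac{n!}{i!}\prod_{j=i+1}^n\lambda_j(DZ)\qquad\text{and}\qquad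 \mathrm{g}_i(Z)\le\frac{n!}{i!}\,\sigma_i(Z).$$ -/

import Mathlib

open scoped Pointwise

noncomputable section

namespace LatticeZonotope

/-- The integer lattice `ℤⁿ` as a subset of `ℝⁿ`. -/
def intLattice (n : ℕ) : Set (Fin n → ℝ) :=
  Set.range fun (z : Fin n → ℤ) (j : Fin n) => (z j : ℝ)

/-- The lattice point enumerator `G(K) = #(K ∩ ℤⁿ)` (used for bounded sets `K`). -/
def latticePointCount {n : ℕ} (K : Set (Fin n → ℝ)) : ℕ :=
  (K ∩ intLattice n).ncard

/-- The dimension of the affine hull of a nonempty set `S ⊆ ℝⁿ`. -/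
def affineDim {n : ℕ} (S : Set (Fin n → ℝ)) : ℕ :=
  Module.finrank ℝ (vectorSpan ℝ S)

/-- `Z` is a lattice zonotope: a Minkowski sum of finitely many segments `[pₖ, pₖ + vₖ]`
with `pₖ, vₖ ∈ ℤⁿ`. -/
def IsLatticeZonotope {n : ℕ} (Z : Set (Fin n → ℝ)) : Prop :=
  ∃ (m : ℕ) (p v : Fin m → Fin n → ℝ),
    (∀ k, p k ∈ intLattice n) ∧ (∀ k, v k ∈ intLattice n) ∧
      Z = {x | ∃ α : Fin m → ℝ, (∀ k, 0 ≤ α k ∧ α k ≤ 1) ∧ x = ∑ k, (p k + α k • v k)}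

/-- The difference body `DK = K - K`. -/
def differenceBody {n : ℕ} (K : Set (Fin n → ℝ)) : Set (Fin n → ℝ) :=
  K - K

/-- The `i`-th successive minimum (`1 ≤ i ≤ n`) of a `0`-symmetric convex body `K` with respect
to `ℤⁿ`: the least `t > 0` such that `tK ∩ ℤⁿ` has dimension at least `i`. -/
def successiveMin {n : ℕ} (K : Set (Fin n → ℝ)) (i : ℕ) : ℝ :=
  sInf {t : ℝ | 0 < t ∧ i ≤ affineDim ((t • K) ∩ intLattice n)}

/-- `σᵢ(P)`: the `i`-th elementary symmetric polynomial evaluated at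
`1 / λ₁(DP), …, 1 / λₙ(DP)`. -/
def sigma {n : ℕ} (P : Set (Fin n → ℝ)) (i : ℕ) : ℝ :=
  ∑ I ∈ (Finset.Icc 1 n).powersetCard i, ∏ j ∈ I, 1 / successiveMin (differenceBody P) j

/-- `q` is the Ehrhart polynomial of `P ⊆ ℝⁿ`: `G(kP) = q(k)` for all `k ∈ ℕ`. -/
def IsEhrhartPolynomial {n : ℕ} (P : Set (Fin n → ℝ)) (q : Polynomial ℝ) : Prop :=
  q.natDegree ≤ n ∧ ∀ k : ℕ, (latticePointCount ((k : ℝ) • P) : ℝ) = q.eval (k : ℝ)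

theorem IsEhrhartPolynomial.unique {n : ℕ} {P : Set (Fin n → ℝ)} {q r : Polynomial ℝ}
    (hq : IsEhrhartPolynomial P q) (hr : IsEhrhartPolynomial P r) : q = r := by
  refine Polynomial.eq_of_infinite_eval_eq q r ?_
  refine (Set.infinite_range_of_injective (Nat.cast_injective (R := ℝ))).mono ?_
  rintro _ ⟨k, rfl⟩
  exact (hq.2 k).symm.trans (hr.2 k)

open Classical in
/-- The `i`-th Ehrhart coefficient `gᵢ(P)`: the coefficient of `kⁱ` in the (unique) Ehrhart
polynomial of `P`. The default value is used only for sets without an Ehrhart polynomial. -/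
def ehrhartCoeff {n : ℕ} (P : Set (Fin n → ℝ)) (i : ℕ) : ℝ :=
  if h : ∃ q : Polynomial ℝ, IsEhrhartPolynomial P q then h.choose.coeff i else 0

/-- The volume (Lebesgue measure) of a subset of `ℝⁿ`, as a real number. -/
def vol {n : ℕ} (K : Set (Fin n → ℝ)) : ℝ :=
  (MeasureTheory.volume K).toReal

end LatticeZonotope

end

/-! Write `Z` as an integer translate of a sum of segments `[0, v]` over a list of integer
generators. For a sublist `X` of the generators let `latticeIndex X` be the index of the group
spanned by `X` in the integer points of its linear hull, or `0` if `X` is dependent.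

Ehrhart coefficients: `g_i` is the sum of the indices of the `i`-element sublists (`ncard_combos`).
By induction on the generators, a unimodular map turns one generator into `d e_0`. Adding the
segment `[0, kd e_0]` to a convex body creates exactly `kd` new lattice points over each lattice
point of its projection (`ncard_add_segment`), and the indices obey the same recursion. The top
coefficient is the volume (`vol_eq`).

First inequality: complete an independent `X` of length `i` to a basis by lattice vectors `w_j ∈ t_j
DZ` with `t_j` close to `λ_j`, `j > i` (`exists_completion`). The index of `X` is at most `|det (X,
w)|`. Each `w_j` is a combination of generators with coefficients in `[-t_j, t_j]`, so
multilinearity bounds this determinant by `∏ t_j` times the sum of `|det (X, v)|` over tuples `v` of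
generators (`abs_detList_append_le`). Summing over `X` meets each `n`-element sublist `n!/i!` times
(`sum_sublistsLen_tupleSum`), which gives `n!/i! · vol Z · ∏ λ_j`.

Second inequality: Minkowski's second theorem, `vol Z · ∏ λ_j ≤ 1`, bounds `vol Z · ∏_{j>i} λ_j` by
`∏_{j≤i} 1/λ_j`, a single term of `σ_i`. It is proved through the volume of the image of `sZ` in the
torus `ℝⁿ/ℤⁿ`. This is at most `1`, equals `vol (sZ)` for `s < λ_1`, and grows at least like
`s^(n-i)` for `s < λ_(i+1)`, because the integer translates that cause overlaps then lie in a
subspace of dimension at most `i` (`quotientVolume_ratio`). -/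

open scoped Pointwise

noncomputable section

namespace LatticeZonotope

/-! ### Determinants of lists of vectors -/

section DetList

variable {R : Type*} [CommRing R] {n : ℕ}

/-- The determinant of a list of `n` row vectors; it is `0` for lists of any other length. -/
def detList (L : List (Fin n → R)) : R :=
  if L.length = n then Matrix.det (Matrix.of fun i : Fin n => L.getD i 0) else 0

theorem detList_append_swap (P Q : List (Fin n → R)) (x y : Fin n → R) :
    detList (P ++ x :: y :: Q) = -detList (P ++ y :: x :: Q) := by
  unfold detList
  simp only [List.length_append, List.length_cons]
  split_ifs with h
  · have h0 : P.length < n := by omega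
    have h1 : P.length + 1 < n := by omega
    have hne : (⟨P.length, h0⟩ : Fin n) ≠ ⟨P.length + 1, h1⟩ := by simp
    have := Matrix.det_permute (Equiv.swap (⟨P.length, h0⟩ : Fin n) ⟨P.length + 1, h1⟩)
      (Matrix.of fun i : Fin n => (P ++ y :: x :: Q).getD i 0)
    rw [Equiv.Perm.sign_swap hne] at this
    have e : (Matrix.of fun i : Fin n => (P ++ x :: y :: Q).getD i 0) =
        (Matrix.of fun i : Fin n => (P ++ y :: x :: Q).getD i 0).submatrix
          (Equiv.swap (⟨P.length, h0⟩ : Fin n) ⟨P.length + 1, h1⟩) id := by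
      ext i j
      simp only [Matrix.of_apply, Matrix.submatrix_apply, id]
      rcases lt_trichotomy (i : ℕ) P.length with hi | hi | hi
      · rw [Equiv.swap_apply_of_ne_of_ne (by simp [Fin.ext_iff]; omega)
          (by simp [Fin.ext_iff]; omega)]
        rw [List.getD_append _ _ _ _ hi, List.getD_append _ _ _ _ hi]
      · have : i = ⟨P.length, h0⟩ := Fin.ext hi
        subst this
        rw [Equiv.swap_apply_left, List.getD_append_right _ _ _ _ le_rfl,
          List.getD_append_right _ _ _ _ (by simp)]
        simp
      · rcases eq_or_ne (i : ℕ) (P.length + 1) with hi' | hi'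
        · have : i = ⟨P.length + 1, h1⟩ := Fin.ext hi'
          subst this
          rw [Equiv.swap_apply_right, List.getD_append_right _ _ _ _ le_rfl,
            List.getD_append_right _ _ _ _ (by simp)]
          simp
        · rw [Equiv.swap_apply_of_ne_of_ne (by simp [Fin.ext_iff]; omega)
            (by simp [Fin.ext_iff]; omega)]
          rw [List.getD_append_right _ _ _ _ hi.le, List.getD_append_right _ _ _ _ hi.le]
          obtain ⟨m, hm⟩ : ∃ m, (i : ℕ) - P.length = m + 2 := ⟨i - P.length - 2, by omega⟩
          rw [hm]
          simp
    rw [e, this]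
    simp
  · simp

theorem detList_cons_cons_self (x : Fin n → R) (Q : List (Fin n → R)) :
    detList (x :: x :: Q) = 0 := by
  unfold detList
  split_ifs with h
  · simp only [List.length_cons] at h
    refine Matrix.det_zero_of_row_eq (i := ⟨0, by omega⟩) (j := ⟨1, by omega⟩) (by simp) ?_
    ext j
    simp
  · rfl

/-- Transfers linearity in the first row from `Matrix.updateRow`; the second alternative absorbs
lists of the wrong length. -/
theorem detList_cons_eq (Q : List (Fin n → R)) :
    (∃ (i : Fin n) (M : Matrix (Fin n) (Fin n) R), ∀ x, detList (x :: Q) = (M.updateRow i x).det) ∨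
      ∀ x, detList (x :: Q) = 0 := by
  by_cases h : Q.length + 1 = n
  · left
    obtain ⟨m, rfl⟩ : ∃ m, n = m + 1 := ⟨_, h.symm⟩
    refine ⟨0, Matrix.of fun i : Fin (m + 1) => (0 :: Q).getD i 0, fun x => ?_⟩
    unfold detList
    rw [if_pos (by simpa using h)]
    congr 1
    ext i j
    refine Fin.cases ?_ (fun i => ?_) i
    · simp
    · rw [Matrix.updateRow_ne (Fin.succ_ne_zero i)]
      simp
  · right
    intro x
    unfold detList
    rw [if_neg (by simpa using h)]

theorem detList_cons_add (x y : Fin n → R) (Q : List (Fin n → R)) :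
    detList ((x + y) :: Q) = detList (x :: Q) + detList (y :: Q) := by
  rcases detList_cons_eq Q with ⟨i, M, h⟩ | h
  · simp only [h, Matrix.det_updateRow_add]
  · simp [h]

theorem detList_cons_smul (c : R) (x : Fin n → R) (Q : List (Fin n → R)) :
    detList ((c • x) :: Q) = c * detList (x :: Q) := by
  rcases detList_cons_eq Q with ⟨i, M, h⟩ | h
  · simp only [h, Matrix.det_updateRow_smul]
  · simp [h]

theorem detList_cons_zero (Q : List (Fin n → R)) :
    detList ((0 : Fin n → R) :: Q) = 0 := by
  simpa using detList_cons_smul (0 : R) 0 Q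

theorem detList_map_ringHom {S : Type*} [CommRing S] (f : R →+* S) (L : List (Fin n → R)) :
    detList (L.map fun v j => f (v j)) = f (detList L) := by
  unfold detList
  simp only [List.length_map]
  split_ifs with h
  · rw [RingHom.map_det]
    congr 1
    ext i j
    simp [h]
  · simp

theorem detList_map_mulVec (A : Matrix (Fin n) (Fin n) R) (L : List (Fin n → R)) :
    detList (L.map A.mulVec) = detList L * A.det := by
  unfold detList
  simp only [List.length_map]
  split_ifs with h
  · rw [← Matrix.det_transpose A, ← Matrix.det_mul]
    congr 1
    ext i j
    simp [h, Matrix.mul_apply, Matrix.mulVec, dotProduct, mul_comm]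
  · simp

/-- Expansion along a first row which is a multiple of the first unit vector. -/
theorem detList_single_cons (d : R) (L : List (Fin (n + 1) → R)) :
    detList (Pi.single 0 d :: L) = d * detList (L.map Fin.tail) := by
  unfold detList
  simp only [List.length_map, List.length_cons, Nat.add_right_cancel_iff]
  split_ifs with h
  · rw [Matrix.det_succ_row_zero, Finset.sum_eq_single 0]
    · simp only [Fin.val_zero, pow_zero, one_mul, Matrix.of_apply, List.getD_cons_zero,
        Pi.single_eq_same]
      congr 2
      ext i j
      simp [h, Fin.tail]
    · intro j _ hj
      simp [hj]
    · simp
  · simp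

theorem detList_ofFn (f : Fin n → Fin n → R) : detList (List.ofFn f) = (Matrix.of f).det := by
  unfold detList
  rw [if_pos (by simp)]
  congr 1
  ext i j
  simp

theorem abs_detList_perm [LinearOrder R] {L L' : List (Fin n → R)} (h : L.Perm L') :
    |detList L| = |detList L'| := by
  -- The arbitrary prefix makes the `cons` case of the induction on permutations immediate.
  suffices H : ∀ P : List (Fin n → R), |detList (P ++ L)| = |detList (P ++ L')| by
    simpa using H []
  induction h with
  | nil => simp
  | cons x _ ih => intro P; simpa using ih (P ++ [x])
  | swap x y l => intro P; rw [detList_append_swap, abs_neg]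
  | trans _ _ ih1 ih2 => intro P; rw [ih1, ih2]

end DetList

/-! ### Double counting of sublists and tuples -/

section DoubleCounting

/-- Each sublist of length `i + 1` arises by choosing which of its `i + 1` entries is put in front;
repeated choices contribute nothing because `F` vanishes on repetitions. -/
theorem sum_sublistsLen_sum_cons {E : Type*} (F : List E → ℝ)
    (hperm : ∀ L L' : List E, L.Perm L' → F L = F L') (hdup : ∀ x L, F (x :: x :: L) = 0)
    (i : ℕ) (l : List E) :
    ((l.sublistsLen i).map fun X => (l.map fun v => F (v :: X)).sum).sum =
      (i + 1) * ((l.sublistsLen (i + 1)).map F).sum := by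
  induction l generalizing i F with
  | nil => cases i <;> simp
  | cons a l ih =>
    cases i with
    | zero =>
      have := ih F hperm hdup 0
      simp only [List.sublistsLen_zero, List.map_cons, List.map_nil, List.sum_cons, List.sum_nil,
        add_zero, List.sublistsLen_succ_cons, List.map_append, List.sum_append] at this ⊢
      rw [this]
      push_cast
      ring
    | succ i =>
      have h1 := ih F hperm hdup (i + 1)
      -- Sublists through `a` are governed by `F (a :: ·)`, which inherits both properties of `F`;
      -- hence the induction over all `F`.
      have h2 := ih (fun L => F (a :: L)) (fun L L' h => hperm _ _ (h.cons a))
        (fun x L => by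
          rw [hperm (a :: x :: x :: L) (x :: x :: a :: L)
            ((List.Perm.swap x a _).trans ((List.Perm.swap x a _).cons x)), hdup]) i
      have h3 : ∀ X v, F (v :: a :: X) = F (a :: v :: X) := fun X v => hperm _ _ (.swap a v X)
      simp only [List.map_cons, List.sum_cons, List.sublistsLen_succ_cons, List.map_append,
        List.map_map, List.sum_append, Function.comp_def, hdup, List.sum_map_add, h3,
        zero_add] at h1 h2 ⊢
      rw [h1, h2]
      push_cast
      ring

/-- The sum of `F (vᵣ :: ⋯ :: v₁ :: X)` over all `r`-tuples of entries of `l`. -/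
def tupleSum {E : Type*} (l : List E) (F : List E → ℝ) : ℕ → List E → ℝ
  | 0, X => F X
  | r + 1, X => (l.map fun v => tupleSum l F r (v :: X)).sum

variable {E : Type*} {l : List E} {F : List E → ℝ}

theorem tupleSum_perm (hperm : ∀ L L' : List E, L.Perm L' → F L = F L') (r : ℕ)
    (L L' : List E) (h : L.Perm L') : tupleSum l F r L = tupleSum l F r L' := by
  induction r generalizing L L' with
  | zero => exact hperm _ _ h
  | succ r ih =>
    simp only [tupleSum]
    congr 1
    exact List.map_congr_left fun v _ => ih _ _ (h.cons v)

theorem tupleSum_dup (hperm : ∀ L L' : List E, L.Perm L' → F L = F L')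
    (hdup : ∀ x L, F (x :: x :: L) = 0) (r : ℕ) (x : E) (L : List E) :
    tupleSum l F r (x :: x :: L) = 0 := by
  induction r generalizing L with
  | zero => exact hdup _ _
  | succ r ih =>
    simp only [tupleSum]
    have : ∀ v, tupleSum l F r (v :: x :: x :: L) = 0 := fun v => by
      rw [tupleSum_perm hperm r _ (x :: x :: v :: L)
        ((List.Perm.swap x v _).trans ((List.Perm.swap x v _).cons x)), ih]
    simp [this]

/-- Extending one entry at a time produces the factors `i + 1, …, i + r`, whose product is `(i + r)!
/ i!`. -/
theorem sum_sublistsLen_tupleSum (hperm : ∀ L L' : List E, L.Perm L' → F L = F L')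
    (hdup : ∀ x L, F (x :: x :: L) = 0) (r i : ℕ) :
    ((l.sublistsLen i).map (tupleSum l F r)).sum =
      ((i + r).factorial / i.factorial : ℝ) * ((l.sublistsLen (i + r)).map F).sum := by
  induction r generalizing i with
  | zero =>
    simp only [add_zero]
    rw [div_self (by positivity), one_mul]
    rfl
  | succ r ih =>
    have := sum_sublistsLen_sum_cons (tupleSum l F r) (tupleSum_perm hperm r)
      (tupleSum_dup hperm hdup r) i l
    simp only [tupleSum]
    rw [this, ih, show i + 1 + r = i + (r + 1) by ring, Nat.factorial_succ i]
    push_cast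
    have : (i.factorial : ℝ) ≠ 0 := by positivity
    field_simp

end DoubleCounting

/-! ### Determinant bounds for bounded combinations -/

section Combos

/-- All linear combinations of the entries of a list with coefficients in `[a, b]`. -/
def combos {E : Type*} [AddCommGroup E] [Module ℝ E] (a b : ℝ) : List E → Set E
  | [] => {0}
  | v :: l => {x | ∃ c ∈ Set.Icc a b, ∃ y ∈ combos a b l, x = c • v + y}

theorem abs_detList_combos_le {n : ℕ} {t : ℝ} {l : List (Fin n → ℝ)} {w : Fin n → ℝ}
    (hw : w ∈ combos (-t) t l) (X : List (Fin n → ℝ)) :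
    |detList (w :: X)| ≤ t * (l.map fun v => |detList (v :: X)|).sum := by
  induction l generalizing w with
  | nil =>
    obtain rfl : w = 0 := hw
    simp [detList_cons_zero]
  | cons v l ih =>
    obtain ⟨c, hc, y, hy, rfl⟩ := hw
    rw [detList_cons_add, detList_cons_smul, List.map_cons, List.sum_cons, mul_add]
    refine (abs_add_le _ _).trans (add_le_add ?_ (ih hy))
    rw [abs_mul]
    exact mul_le_mul_of_nonneg_right (abs_le.2 hc) (abs_nonneg _)

/-- Expands the rows one after another. A generator replacing the first row is moved behind the
remaining `ws` into `X`, so that the next of these rows becomes the first. -/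
theorem abs_detList_append_le {n : ℕ} {l : List (Fin n → ℝ)}
    (ws : List ((Fin n → ℝ) × ℝ)) (h0 : ∀ w ∈ ws, 0 ≤ w.2)
    (hws : ∀ w ∈ ws, w.1 ∈ combos (-w.2) w.2 l) (X : List (Fin n → ℝ)) :
    |detList (ws.map Prod.fst ++ X)| ≤
      (ws.map Prod.snd).prod * tupleSum l (fun L => |detList L|) ws.length X := by
  induction ws generalizing X with
  | nil => simp [tupleSum]
  | cons w ws ih =>
    have hw := h0 w (by simp)
    simp only [List.map_cons, List.cons_append, List.prod_cons, List.length_cons, tupleSum]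
    refine (abs_detList_combos_le (hws w (by simp)) _).trans ?_
    rw [mul_assoc]
    refine mul_le_mul_of_nonneg_left ?_ hw
    rw [← List.sum_map_mul_left]
    refine List.sum_le_sum fun v _ => ?_
    rw [← abs_detList_perm (List.perm_middle (l₁ := ws.map Prod.fst) (a := v) (l₂ := X))]
    exact ih (fun w hw => h0 w (by simp [hw])) (fun w hw => hws w (by simp [hw])) _

end Combos

/-! ### Lattice indices of integer vectors -/

section LatticeIndex

variable {n : ℕ}

/-- For linearly independent `X` this is the index of the group spanned by `X` in the group of
integer points of its linear hull; for dependent `X` it is `0`. -/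
def latticeIndex (X : List (Fin n → ℤ)) : ℕ :=
  sInf {m | m ≠ 0 ∧ ∃ a : List (Fin n → ℤ), m = (detList (X ++ a)).natAbs}

theorem latticeIndex_le (X a : List (Fin n → ℤ)) (h : detList (X ++ a) ≠ 0) :
    latticeIndex X ≤ (detList (X ++ a)).natAbs :=
  Nat.sInf_le ⟨by simpa using h, a, rfl⟩

theorem exists_of_latticeIndex_ne_zero {X : List (Fin n → ℤ)} (h : latticeIndex X ≠ 0) :
    ∃ a, detList (X ++ a) ≠ 0 := by
  by_contra! H
  refine h ?_
  unfold latticeIndex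
  simp [H]

theorem latticeIndex_of_length_eq {X : List (Fin n → ℤ)} (h : X.length = n) :
    latticeIndex X = (detList X).natAbs := by
  have key : ∀ a, detList (X ++ a) ≠ 0 → a = [] := by
    intro a ha
    unfold detList at ha
    by_contra hne
    refine ha (if_neg ?_)
    have := List.length_pos_of_ne_nil hne
    rw [List.length_append]
    omega
  by_cases h0 : detList X = 0
  · by_contra hne
    have : latticeIndex X ≠ 0 := fun h' => hne (by simp [h', h0])
    obtain ⟨a, ha⟩ := exists_of_latticeIndex_ne_zero this
    obtain rfl := key a ha
    simp [h0] at ha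
  · refine le_antisymm (by simpa using latticeIndex_le X [] (by simpa using h0)) ?_
    refine le_csInf ⟨(detList X).natAbs, by simpa using h0, [], by simp⟩ ?_
    rintro m ⟨hm, a, rfl⟩
    obtain rfl := key a (by simpa using hm)
    simp

theorem latticeIndex_nil : latticeIndex ([] : List (Fin n → ℤ)) = 1 := by
  have h1 : detList (List.ofFn fun i : Fin n => (Pi.single i 1 : Fin n → ℤ)) = 1 := by
    rw [detList_ofFn]
    convert Matrix.det_one (R := ℤ) (n := Fin n)
    ext i j
    simp [Matrix.one_apply, Pi.single_apply, eq_comm]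
  refine le_antisymm ?_ ?_
  · have := latticeIndex_le [] (List.ofFn fun i : Fin n => (Pi.single i 1 : Fin n → ℤ)) (by simp [h1])
    simpa [h1] using this
  · refine le_csInf ⟨1, by simp, List.ofFn fun i : Fin n => (Pi.single i 1 : Fin n → ℤ), by simp [h1]⟩ ?_
    rintro m ⟨hm, -⟩
    omega

theorem latticeIndex_cons_zero (X : List (Fin n → ℤ)) : latticeIndex (0 :: X) = 0 := by
  by_contra h
  obtain ⟨a, ha⟩ := exists_of_latticeIndex_ne_zero h
  exact ha (detList_cons_zero _)

/-- A unimodular matrix permutes the possible completions and keeps absolute determinants. -/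
theorem latticeIndex_map (A B : Matrix (Fin n) (Fin n) ℤ) (hAB : A * B = 1)
    (X : List (Fin n → ℤ)) : latticeIndex (X.map A.mulVec) = latticeIndex X := by
  unfold latticeIndex
  have hdet : A.det.natAbs = 1 := by
    rw [← Int.isUnit_iff_natAbs_eq]
    exact IsUnit.of_mul_eq_one B.det (by rw [← Matrix.det_mul, hAB, Matrix.det_one])
  have key : ∀ a, (detList ((X ++ a).map A.mulVec)).natAbs = (detList (X ++ a)).natAbs := by
    intro a
    rw [detList_map_mulVec, Int.natAbs_mul, hdet, mul_one]
  congr 1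
  ext m
  refine and_congr_right fun _ => ⟨?_, ?_⟩
  · rintro ⟨a, ha⟩
    refine ⟨a.map B.mulVec, ?_⟩
    rw [ha, ← key]
    simp [Function.comp_def, hAB]
  · rintro ⟨a, ha⟩
    refine ⟨a.map A.mulVec, ?_⟩
    rw [ha, ← key]
    simp

/-- Expansion along the first row makes every completed determinant `d` times one of the projected
vectors, and every completion downstairs lifts. -/
theorem latticeIndex_single_cons {d : ℤ} (hd : d ≠ 0) (X : List (Fin (n + 1) → ℤ)) :
    latticeIndex (Pi.single 0 d :: X) = d.natAbs * latticeIndex (X.map Fin.tail) := by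
  have key : ∀ a : List (Fin (n + 1) → ℤ), (detList (Pi.single 0 d :: X ++ a)).natAbs =
      d.natAbs * (detList (X.map Fin.tail ++ a.map Fin.tail)).natAbs := by
    intro a
    rw [List.cons_append, detList_single_cons, Int.natAbs_mul, List.map_append]
  have hd' : d.natAbs ≠ 0 := by simpa using hd
  by_cases h0 : latticeIndex (X.map Fin.tail) = 0
  · rw [h0, mul_zero]
    by_contra h
    obtain ⟨a, ha⟩ := exists_of_latticeIndex_ne_zero h
    have h1 := key a
    have : detList (X.map Fin.tail ++ a.map Fin.tail) = 0 := by
      by_contra h2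
      have h3 := Nat.sInf_eq_zero.1 h0
      simp only [Set.mem_ofPred_eq, ne_eq, not_true_eq_false, false_and, false_or] at h3
      exact Set.eq_empty_iff_forall_notMem.1 h3 _ ⟨by simpa using h2, _, rfl⟩
    rw [this] at h1
    simp at h1
    exact ha (by simpa using h1)
  · have hmem := Nat.sInf_mem (Nat.nonempty_of_pos_sInf (Nat.pos_of_ne_zero h0))
    obtain ⟨-, a, ha⟩ := hmem
    change latticeIndex _ = _ at ha
    have hsurj : (a.map fun v => (Fin.cons 0 v : Fin (n + 1) → ℤ)).map Fin.tail = a := by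
      simp [Function.comp_def]
    refine le_antisymm ?_ ?_
    · rw [ha, ← hsurj, ← key]
      refine latticeIndex_le _ _ ?_
      rw [← Int.natAbs_ne_zero, key, hsurj, ← ha]
      exact mul_ne_zero hd' h0
    · refine le_csInf ⟨_, ?_, (a.map fun v => (Fin.cons 0 v : Fin (n + 1) → ℤ)), rfl⟩ ?_
      · rw [key, hsurj, ← ha]
        exact mul_ne_zero hd' h0
      · rintro m ⟨hm, b, rfl⟩
        rw [key] at hm ⊢
        refine Nat.mul_le_mul_left _ (latticeIndex_le _ _ ?_)
        rw [← Int.natAbs_ne_zero]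
        exact right_ne_zero_of_mul hm

/-- The sum of the lattice indices of the sublists of length `i`. -/
def indexSum (l : List (Fin n → ℤ)) (i : ℕ) : ℕ := ((l.sublistsLen i).map latticeIndex).sum

theorem indexSum_zero (l : List (Fin n → ℤ)) : indexSum l 0 = 1 := by
  simp [indexSum, latticeIndex_nil]

theorem indexSum_nil_succ (i : ℕ) : indexSum ([] : List (Fin n → ℤ)) (i + 1) = 0 := by
  simp [indexSum]

theorem indexSum_zero_cons (l : List (Fin n → ℤ)) (i : ℕ) :
    indexSum (0 :: l) i = indexSum l i := by
  cases i with
  | zero => simp [indexSum_zero]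
  | succ i => simp [indexSum, List.sublistsLen_succ_cons, Function.comp_def, latticeIndex_cons_zero]

theorem sublistsLen_map {α β : Type*} (f : α → β) (l : List α) (i : ℕ) :
    (l.map f).sublistsLen i = (l.sublistsLen i).map (List.map f) := by
  induction l generalizing i with
  | nil => cases i <;> simp
  | cons a l ih =>
    cases i with
    | zero => simp
    | succ i => simp [List.sublistsLen_succ_cons, ih, Function.comp_def]

theorem indexSum_map (A B : Matrix (Fin n) (Fin n) ℤ) (hAB : A * B = 1)
    (l : List (Fin n → ℤ)) (i : ℕ) : indexSum (l.map A.mulVec) i = indexSum l i := by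
  unfold indexSum
  rw [sublistsLen_map, List.map_map]
  congr 1
  exact List.map_congr_left fun X _ => latticeIndex_map A B hAB X

/-- Splits sublists by whether they use the head. This is the recursion that the lattice point count
obeys in `ncard_add_segment`. -/
theorem indexSum_single_cons_succ {d : ℤ} (hd : d ≠ 0) (l : List (Fin (n + 1) → ℤ)) (i : ℕ) :
    indexSum (Pi.single 0 d :: l) (i + 1) =
      indexSum l (i + 1) + d.natAbs * indexSum (l.map Fin.tail) i := by
  unfold indexSum
  rw [List.sublistsLen_succ_cons, List.map_append, List.sum_append, List.map_map, sublistsLen_map,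
    List.map_map, ← List.sum_map_mul_left]
  congr 2
  exact List.map_congr_left fun X _ => latticeIndex_single_cons hd X

end LatticeIndex

/-! ### Geometry of sets of bounded combinations -/

section Combos

variable {E F : Type*} [AddCommGroup E] [Module ℝ E] [AddCommGroup F] [Module ℝ F] {a b : ℝ}

theorem combos_cons_eq (v : E) (l : List E) :
    combos a b (v :: l) = (fun c : ℝ => c • v) '' Set.Icc a b + combos a b l := by
  ext x
  simp only [combos, Set.mem_ofPred_eq, Set.mem_add, Set.mem_image]
  constructor
  · rintro ⟨c, hc, y, hy, rfl⟩
    exact ⟨_, ⟨c, hc, rfl⟩, y, hy, rfl⟩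
  · rintro ⟨_, ⟨c, hc, rfl⟩, y, hy, rfl⟩
    exact ⟨c, hc, y, hy, rfl⟩

theorem convex_combos (l : List E) : Convex ℝ (combos a b l) := by
  induction l with
  | nil => exact convex_singleton 0
  | cons v l ih =>
    rw [combos_cons_eq]
    exact ((convex_Icc a b).is_linear_image ⟨fun x y => add_smul x y v,
      fun c x => by simp [mul_smul]⟩).add ih

theorem isCompact_combos [TopologicalSpace E] [ContinuousAdd E] [ContinuousSMul ℝ E]
    (l : List E) : IsCompact (combos a b l) := by
  induction l with
  | nil => exact isCompact_singleton
  | cons v l ih =>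
    rw [combos_cons_eq]
    exact (isCompact_Icc.image (by fun_prop)).add ih

theorem combos_map (f : E →ₗ[ℝ] F) (l : List E) : combos a b (l.map f) = f '' combos a b l := by
  induction l with
  | nil => simp [combos]
  | cons v l ih =>
    rw [List.map_cons, combos_cons_eq, combos_cons_eq, Set.image_add, ih, Set.image_image]
    simp

theorem combos_cons_zero (hab : a ≤ b) (l : List E) : combos a b (0 :: l) = combos a b l := by
  ext x
  simp only [combos, Set.mem_ofPred_eq, smul_zero, zero_add]
  constructor
  · rintro ⟨c, hc, y, hy, rfl⟩
    exact hy
  · intro hx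
    exact ⟨a, ⟨le_rfl, hab⟩, x, hx, rfl⟩

theorem smul_combos {t : ℝ} (ht : 0 ≤ t) (hab : a ≤ b) (l : List E) :
    t • combos a b l = combos (t * a) (t * b) l := by
  induction l with
  | nil => simp [combos]
  | cons v l ih =>
    rw [combos_cons_eq, combos_cons_eq, smul_add, ih]
    congr 1
    ext x
    simp only [Set.mem_smul_set, Set.mem_image, Set.mem_Icc]
    constructor
    · rintro ⟨_, ⟨c, ⟨h1, h2⟩, rfl⟩, rfl⟩
      exact ⟨t * c, ⟨by gcongr, by gcongr⟩, mul_smul _ _ _⟩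
    · rintro ⟨c, ⟨h1, h2⟩, rfl⟩
      rcases ht.eq_or_lt with rfl | ht
      · obtain rfl : c = 0 := by linarith
        exact ⟨_, ⟨a, ⟨le_rfl, hab⟩, rfl⟩, by simp⟩
      · refine ⟨_, ⟨t⁻¹ * c, ⟨?_, ?_⟩, rfl⟩, ?_⟩
        · rw [inv_mul_eq_div, le_div_iff₀ ht]; linarith
        · rw [inv_mul_eq_div, div_le_iff₀ ht]; linarith
        · rw [smul_smul, mul_inv_cancel_left₀ ht.ne']

end Combos

/-! ### Counting the lattice points of dilated zonotopes -/

section Count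

variable {n : ℕ}

/-- An integer vector, seen as a real vector. -/
def intVec (z : Fin n → ℤ) : Fin n → ℝ := fun j => (z j : ℝ)

theorem intVec_injective : Function.Injective (intVec (n := n)) := fun x y h => by
  ext j
  exact Int.cast_injective (α := ℝ) (congrFun h j)

theorem latticePointCount_eq (K : Set (Fin n → ℝ)) :
    latticePointCount K = (intVec ⁻¹' K).ncard := by
  rw [← Set.ncard_image_of_injective _ intVec_injective, Set.image_preimage_eq_inter_range]
  rfl

theorem finite_preimage_intVec {C : Set (Fin n → ℝ)} (hC : Bornology.IsBounded C) :
    (intVec ⁻¹' C).Finite := by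
  obtain ⟨R, hR⟩ := hC.exists_norm_le
  refine (Set.finite_Icc (fun _ : Fin n => -⌈R⌉) fun _ : Fin n => ⌈R⌉).subset fun z hz => ?_
  have key : ∀ j, |(z j : ℝ)| ≤ ⌈R⌉ := fun j =>
    ((norm_le_pi_norm (intVec z) j).trans (hR _ hz)).trans (Int.le_ceil R)
  constructor
  · intro j
    have := (abs_le.1 (key j)).1
    exact_mod_cast this
  · intro j
    have := (abs_le.1 (key j)).2
    exact_mod_cast this

theorem ncard_fibered (W : Finset (Fin n → ℤ)) (p q : (Fin n → ℤ) → ℤ) :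
    {z : Fin (n + 1) → ℤ | Fin.tail z ∈ W ∧ p (Fin.tail z) ≤ z 0 ∧ z 0 ≤ q (Fin.tail z)}.ncard =
      ∑ w ∈ W, (q w + 1 - p w).toNat := by
  have e : {z : Fin (n + 1) → ℤ | Fin.tail z ∈ W ∧ p (Fin.tail z) ≤ z 0 ∧ z 0 ≤ q (Fin.tail z)} =
      (fun x : (_ : Fin n → ℤ) × ℤ => (Fin.cons x.2 x.1 : Fin (n + 1) → ℤ)) ''
        (W.sigma fun w => Finset.Icc (p w) (q w)) := by
    ext z
    simp only [Set.mem_ofPred_eq, Set.mem_image, Finset.mem_coe, Finset.mem_sigma, Finset.mem_Icc]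
    constructor
    · rintro ⟨h1, h2, h3⟩
      exact ⟨⟨Fin.tail z, z 0⟩, ⟨h1, h2, h3⟩, Fin.cons_self_tail z⟩
    · rintro ⟨⟨w, t⟩, ⟨h1, h2, h3⟩, rfl⟩
      exact ⟨by simpa using h1, by simpa using h2, by simpa using h3⟩
  rw [e, Set.ncard_image_of_injective, Set.ncard_coe_finset, Finset.card_sigma]
  · simp
  · rintro ⟨w, t⟩ ⟨w', t'⟩ h
    obtain ⟨h1, h2⟩ := Fin.cons_inj.1 h
    simp only at h1 h2
    subst h1 h2
    rfl

theorem exists_fiber_eq_Icc {C : Set (Fin (n + 1) → ℝ)} (hconv : Convex ℝ C) (hcomp : IsCompact C)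
    {w : Fin n → ℝ} (hw : w ∈ Fin.tail '' C) :
    ∃ a b : ℝ, a ≤ b ∧ ∀ t : ℝ, (Fin.cons t w : Fin (n + 1) → ℝ) ∈ C ↔ a ≤ t ∧ t ≤ b := by
  have hI : ∀ t : ℝ, (Fin.cons t w : Fin (n + 1) → ℝ) ∈ C ↔
      t ∈ (fun x : Fin (n + 1) → ℝ => x 0) '' (C ∩ Fin.tail ⁻¹' {w}) := by
    intro t
    constructor
    · intro h
      exact ⟨_, ⟨h, by simp⟩, by simp⟩
    · rintro ⟨x, ⟨hx, rfl⟩, rfl⟩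
      simpa [Fin.cons_self_tail] using hx
  have htail : Continuous (Fin.tail : (Fin (n + 1) → ℝ) → Fin n → ℝ) :=
    continuous_pi fun j => continuous_apply _
  have hco : IsCompact ((fun x : Fin (n + 1) → ℝ => x 0) '' (C ∩ Fin.tail ⁻¹' {w})) :=
    (hcomp.inter_right (isClosed_singleton.preimage htail)).image (continuous_apply 0)
  have hcv : Convex ℝ ((fun x : Fin (n + 1) → ℝ => x 0) '' (C ∩ Fin.tail ⁻¹' {w})) := by
    refine Convex.is_linear_image (hconv.inter ?_) ⟨fun _ _ => rfl, fun _ _ => rfl⟩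
    exact (convex_singleton w).is_linear_preimage (f := (Fin.tail : (Fin (n + 1) → ℝ) → _))
      ⟨fun _ _ => rfl, fun _ _ => rfl⟩
  obtain ⟨x, hx, hxw⟩ := hw
  have hne : ((fun x : Fin (n + 1) → ℝ => x 0) '' (C ∩ Fin.tail ⁻¹' {w})).Nonempty :=
    ⟨_, x, ⟨hx, hxw⟩, rfl⟩
  have h := eq_Icc_of_connected_compact ⟨hne, hcv.isPreconnected⟩ hco
  refine ⟨_, _, ?_, fun t => by rw [hI, h, Set.mem_Icc]⟩
  rw [h] at hne
  exact Set.nonempty_Icc.1 hne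

/-- The fibre of `C` over a point of its projection is an interval `[a, b]`, which the segment
enlarges to `[a, b + s]`. As `s` is an integer, each fibre over a lattice point gains exactly `s`
lattice points. -/
theorem ncard_add_segment {C : Set (Fin (n + 1) → ℝ)} (hconv : Convex ℝ C) (hcomp : IsCompact C)
    (s : ℕ) :
    (intVec ⁻¹' {x : Fin (n + 1) → ℝ |
        ∃ c ∈ Set.Icc (0 : ℝ) s, ∃ y ∈ C, x = c • Pi.single 0 1 + y}).ncard =
      (intVec ⁻¹' C).ncard + s * (intVec ⁻¹' (Fin.tail '' C)).ncard := by
  have htail : Continuous (Fin.tail : (Fin (n + 1) → ℝ) → Fin n → ℝ) :=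
    continuous_pi fun j => continuous_apply _
  have hfin : (intVec ⁻¹' (Fin.tail '' C)).Finite :=
    finite_preimage_intVec (hcomp.image htail).isBounded
  have hab : ∀ w : Fin n → ℤ, ∃ a b : ℝ, intVec w ∈ Fin.tail '' C → a ≤ b ∧
      ∀ t : ℝ, (Fin.cons t (intVec w) : Fin (n + 1) → ℝ) ∈ C ↔ a ≤ t ∧ t ≤ b := by
    intro w
    by_cases hw : intVec w ∈ Fin.tail '' C
    · obtain ⟨a, b, h⟩ := exists_fiber_eq_Icc hconv hcomp hw
      exact ⟨a, b, fun _ => h⟩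
    · exact ⟨0, 0, fun h => absurd h hw⟩
  choose a b hab using hab
  have hz : ∀ z : Fin (n + 1) → ℤ, intVec z = Fin.cons (z 0 : ℝ) (intVec (Fin.tail z)) := by
    intro z
    ext j
    refine Fin.cases ?_ (fun j => ?_) j <;> simp [intVec, Fin.tail]
  have e1 : intVec ⁻¹' C = {z : Fin (n + 1) → ℤ | Fin.tail z ∈ hfin.toFinset ∧
      ⌈a (Fin.tail z)⌉ ≤ z 0 ∧ z 0 ≤ ⌊b (Fin.tail z)⌋} := by
    ext z
    simp only [Set.mem_preimage, Set.mem_ofPred_eq, Set.Finite.mem_toFinset, Int.ceil_le,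
      Int.le_floor]
    constructor
    · intro h
      have hw : intVec (Fin.tail z) ∈ Fin.tail '' C := ⟨_, h, rfl⟩
      exact ⟨hw, ((hab _ hw).2 _).1 (by rwa [← hz])⟩
    · rintro ⟨hw, h⟩
      rw [hz]
      exact ((hab _ hw).2 _).2 h
  have e2 : intVec ⁻¹' {x : Fin (n + 1) → ℝ |
        ∃ c ∈ Set.Icc (0 : ℝ) s, ∃ y ∈ C, x = c • Pi.single 0 1 + y} =
      {z : Fin (n + 1) → ℤ | Fin.tail z ∈ hfin.toFinset ∧
      ⌈a (Fin.tail z)⌉ ≤ z 0 ∧ z 0 ≤ ⌊b (Fin.tail z)⌋ + s} := by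
    ext z
    simp only [Set.mem_preimage, Set.mem_ofPred_eq, Set.Finite.mem_toFinset, Int.ceil_le,
      ← sub_le_iff_le_add, Int.le_floor]
    push_cast
    constructor
    · rintro ⟨c, ⟨hc0, hcs⟩, y, hy, h⟩
      have hyz : y = Fin.cons ((z 0 : ℝ) - c) (intVec (Fin.tail z)) := by
        have : y = intVec z - c • Pi.single 0 1 := by rw [h]; simp
        rw [this, hz]
        ext j
        refine Fin.cases ?_ (fun j => ?_) j <;> simp
      have hw : intVec (Fin.tail z) ∈ Fin.tail '' C := ⟨y, hy, by rw [hyz]; simp⟩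
      have := ((hab _ hw).2 _).1 (hyz ▸ hy)
      exact ⟨hw, by linarith, by linarith⟩
    · rintro ⟨hw, h1, h2⟩
      obtain ⟨hle, hC⟩ := hab _ hw
      -- The least shift bringing `z 0` down into `[a, b]`.
      refine ⟨max 0 (z 0 - b (Fin.tail z)), ⟨le_max_left _ _, ?_⟩,
        Fin.cons ((z 0 : ℝ) - max 0 (z 0 - b (Fin.tail z))) (intVec (Fin.tail z)), ?_, ?_⟩
      · exact max_le (by positivity) (by linarith)
      · rw [hC]
        constructor
        · rcases max_cases 0 ((z 0 : ℝ) - b (Fin.tail z)) with h | h <;> linarith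
        · linarith [le_max_right 0 ((z 0 : ℝ) - b (Fin.tail z))]
      · rw [hz]
        ext j
        refine Fin.cases ?_ (fun j => ?_) j <;> simp
  rw [e1, e2, ncard_fibered _ (fun w => ⌈a w⌉) fun w => ⌊b w⌋ + s,
    ncard_fibered _ (fun w => ⌈a w⌉) fun w => ⌊b w⌋, Set.ncard_eq_toFinset_card _ hfin, mul_comm,
    ← smul_eq_mul, ← Finset.sum_const, ← Finset.sum_add_distrib]
  refine Finset.sum_congr rfl fun w hw => ?_
  have hle := (hab w (by simpa using hw)).1
  -- Keeps `toNat` from truncating, so that a fibre without integers also gains exactly `s`.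
  have : ⌈a w⌉ ≤ ⌊b w⌋ + 1 := by
    have := Int.ceil_lt_add_one (a w)
    have h' := Int.lt_floor_add_one (b w)
    have : ((⌈a w⌉ : ℤ) : ℝ) < ((⌊b w⌋ + 2 : ℤ) : ℝ) := by push_cast; linarith
    have := Int.cast_lt.1 this
    omega
  omega

theorem intVec_mulVec (A : Matrix (Fin n) (Fin n) ℤ) (z : Fin n → ℤ) :
    intVec (A.mulVec z) = (A.map (Int.cast : ℤ → ℝ)).mulVec (intVec z) := by
  ext j
  simp [intVec, Matrix.mulVec, dotProduct]

theorem ncard_mulVec_image {A B : Matrix (Fin n) (Fin n) ℤ} (hAB : A * B = 1) (hBA : B * A = 1)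
    (C : Set (Fin n → ℝ)) :
    (intVec ⁻¹' ((A.map (Int.cast : ℤ → ℝ)).mulVec '' C)).ncard = (intVec ⁻¹' C).ncard := by
  have hBA' : B.map (Int.cast : ℤ → ℝ) * A.map (Int.cast : ℤ → ℝ) = 1 := by
    have := congrArg (fun M => M.map (Int.castRingHom ℝ)) hBA
    rw [Matrix.map_mul, Matrix.map_one _ (map_zero _) (map_one _)] at this
    exact this
  have hinj : Function.Injective A.mulVec := fun x y h => by
    simpa [hBA] using congrArg B.mulVec h
  have : intVec ⁻¹' ((A.map (Int.cast : ℤ → ℝ)).mulVec '' C) = A.mulVec '' (intVec ⁻¹' C) := by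
    ext z
    constructor
    · rintro ⟨x, hx, h⟩
      refine ⟨B.mulVec z, ?_, by simp [hAB]⟩
      rw [Set.mem_preimage, intVec_mulVec, ← h, Matrix.mulVec_mulVec, hBA', Matrix.one_mulVec]
      exact hx
    · rintro ⟨x, hx, rfl⟩
      exact ⟨_, hx, (intVec_mulVec _ _).symm⟩
  rw [this, Set.ncard_image_of_injective _ hinj]

/-- The Smith normal form of `ℤv` gives a basis of the lattice with `v` a multiple of one member;
taking coordinates in it, with a swap and possibly a sign change, sends `v` to `d e_0` with `d > 0`.
-/
theorem exists_unimodular {v : Fin (n + 1) → ℤ} (hv : v ≠ 0) :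
    ∃ (A B : Matrix (Fin (n + 1)) (Fin (n + 1)) ℤ) (d : ℕ),
      A * B = 1 ∧ B * A = 1 ∧ d ≠ 0 ∧ A.mulVec v = Pi.single 0 (d : ℤ) := by
  have key : ∃ (e : (Fin (n + 1) → ℤ) ≃ₗ[ℤ] (Fin (n + 1) → ℤ)) (d : ℤ), e v = Pi.single 0 d := by
    obtain ⟨k, snf⟩ := (Submodule.span ℤ {v}).smithNormalForm (Pi.basisFun ℤ (Fin (n + 1)))
    have hk : k = 1 := by
      rw [← Fintype.card_fin k, ← Module.finrank_eq_card_basis snf.bN,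
        ← (LinearEquiv.toSpanNonzeroSingleton ℤ _ v hv).finrank_eq, Module.finrank_self]
    subst hk
    have h1 : v = (snf.bN.repr ⟨v, Submodule.mem_span_singleton_self v⟩ 0 * snf.a 0) •
        snf.bM (snf.f 0) := by
      have := congrArg Subtype.val
        (snf.bN.sum_repr ⟨v, Submodule.mem_span_singleton_self v⟩)
      simp only [Fin.sum_univ_one, Submodule.coe_smul, snf.snf] at this
      rw [mul_smul]
      exact this.symm
    refine ⟨(snf.bM.reindex (Equiv.swap (snf.f 0) 0)).equivFun,
      snf.bN.repr ⟨v, Submodule.mem_span_singleton_self v⟩ 0 * snf.a 0, ?_⟩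
    refine (congrArg _ h1).trans ?_
    ext j
    rw [map_smul, Pi.smul_apply, Module.Basis.equivFun_apply, Module.Basis.repr_reindex_apply,
      Module.Basis.repr_self, Finsupp.single_apply, Pi.single_apply, Equiv.symm_swap]
    have : snf.f 0 = Equiv.swap (snf.f 0) 0 j ↔ j = 0 := by
      rw [← Equiv.swap_apply_eq_iff, Equiv.swap_apply_left, eq_comm]
    simp [this]
  obtain ⟨e, d, he⟩ := key
  have hd : d ≠ 0 := by
    rintro rfl
    rw [Pi.single_zero] at he
    exact hv (by simpa using he)
  have h1 : LinearMap.toMatrix' (e : (Fin (n + 1) → ℤ) →ₗ[ℤ] (Fin (n + 1) → ℤ)) *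
      LinearMap.toMatrix' (e.symm : (Fin (n + 1) → ℤ) →ₗ[ℤ] (Fin (n + 1) → ℤ)) = 1 := by
    rw [← LinearMap.toMatrix'_comp]; simp
  have h2 : LinearMap.toMatrix' (e.symm : (Fin (n + 1) → ℤ) →ₗ[ℤ] (Fin (n + 1) → ℤ)) *
      LinearMap.toMatrix' (e : (Fin (n + 1) → ℤ) →ₗ[ℤ] (Fin (n + 1) → ℤ)) = 1 := by
    rw [← LinearMap.toMatrix'_comp]; simp
  rcases le_total 0 d with h | h
  · refine ⟨_, _, d.natAbs, h1, h2, by simpa using hd, ?_⟩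
    rw [LinearMap.toMatrix'_mulVec, Int.natAbs_of_nonneg h]
    exact he
  · refine ⟨_, _, d.natAbs, (neg_mul_neg _ _).trans h1, (neg_mul_neg _ _).trans h2,
      by simpa using hd, ?_⟩
    rw [Matrix.neg_mulVec, LinearMap.toMatrix'_mulVec, Int.ofNat_natAbs_of_nonpos h, Pi.single_neg]
    exact congrArg _ he

/-- Induction on the number of generators, over all dimensions at once because the projection along
one generator lowers `n`. -/
theorem ncard_combos (l : List (Fin n → ℤ)) (k : ℕ) :
    (intVec ⁻¹' combos 0 (k : ℝ) (l.map intVec)).ncard =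
      ∑ i ∈ Finset.range (n + 1), indexSum l i * k ^ i := by
  obtain ⟨N, hN⟩ : ∃ N, l.length = N := ⟨_, rfl⟩
  induction N generalizing n l with
  | zero =>
    obtain rfl := List.length_eq_zero_iff.1 hN
    rw [Finset.sum_range_succ', Finset.sum_eq_zero (by simp [indexSum_nil_succ])]
    have : intVec ⁻¹' combos 0 (k : ℝ) ([] : List (Fin n → ℝ)) = {0} := by
      ext z
      simp only [combos, Set.mem_preimage, Set.mem_singleton_iff]
      rw [← intVec_injective.eq_iff]
      simp [funext_iff, intVec]
    simp [this, indexSum_zero]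
  | succ N ih =>
    obtain ⟨v, l, rfl⟩ := List.exists_cons_of_length_eq_add_one hN
    have hlen : l.length = N := by simpa using hN
    by_cases hv : v = 0
    · subst hv
      have : intVec (0 : Fin n → ℤ) = 0 := by ext; simp [intVec]
      rw [List.map_cons, this, combos_cons_zero (by positivity), ih l hlen]
      simp [indexSum_zero_cons]
    · obtain ⟨m, rfl⟩ : ∃ m, n = m + 1 := by
        cases n with
        | zero => exact absurd (Subsingleton.elim _ _) hv
        | succ m => exact ⟨m, rfl⟩
      obtain ⟨A, B, d, hAB, hBA, hd, hAv⟩ := exists_unimodular hv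
      have hmap : ∀ L : List (Fin (m + 1) → ℤ),
          (intVec ⁻¹' combos 0 (k : ℝ) ((L.map A.mulVec).map intVec)).ncard =
            (intVec ⁻¹' combos 0 (k : ℝ) (L.map intVec)).ncard := by
        intro L
        rw [← ncard_mulVec_image hAB hBA (combos 0 (k : ℝ) (L.map intVec))]
        congr 2
        have := combos_map (a := 0) (b := (k : ℝ))
          (Matrix.mulVecLin (A.map (Int.cast : ℤ → ℝ))) (L.map intVec)
        rw [Matrix.coe_mulVecLin] at this
        rw [← this]
        simp [Function.comp_def, intVec_mulVec]
      rw [← hmap, List.map_cons, hAv, List.map_cons]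
      have hseg : combos 0 (k : ℝ) (intVec (Pi.single 0 (d : ℤ)) :: (l.map A.mulVec).map intVec) =
          {x : Fin (m + 1) → ℝ | ∃ c ∈ Set.Icc (0 : ℝ) ((d * k : ℕ) : ℝ),
            ∃ y ∈ combos 0 (k : ℝ) ((l.map A.mulVec).map intVec), x = c • Pi.single 0 1 + y} := by
        have hs : intVec (Pi.single 0 (d : ℤ)) = (d : ℝ) • (Pi.single 0 1 : Fin (m + 1) → ℝ) := by
          ext j
          simp only [intVec, Pi.single_apply, Pi.smul_apply]
          split_ifs <;> simp
        have hd' : (0 : ℝ) < d := by positivity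
        ext x
        simp only [combos, Set.mem_ofPred_eq, hs, smul_smul, Nat.cast_mul]
        constructor
        · rintro ⟨c, ⟨h1, h2⟩, y, hy, rfl⟩
          exact ⟨c * d, ⟨by positivity, by rw [mul_comm]; gcongr⟩, y, hy, rfl⟩
        · rintro ⟨c, ⟨h1, h2⟩, y, hy, rfl⟩
          refine ⟨c / d, ⟨by positivity, ?_⟩, y, hy, by rw [div_mul_cancel₀ _ hd'.ne']⟩
          rw [div_le_iff₀ hd']
          linarith
      have htl : Fin.tail '' combos 0 (k : ℝ) ((l.map A.mulVec).map intVec) =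
          combos 0 (k : ℝ) (((l.map A.mulVec).map Fin.tail).map intVec) := by
        have := combos_map (a := 0) (b := (k : ℝ)) (LinearMap.funLeft ℝ ℝ (Fin.succ (n := m)))
          ((l.map A.mulVec).map intVec)
        have h2 : (LinearMap.funLeft ℝ ℝ (Fin.succ (n := m)) : (Fin (m + 1) → ℝ) → _) =
          Fin.tail := rfl
        rw [h2] at this
        rw [← this]
        simp only [List.map_map]
        rfl
      rw [hseg, ncard_add_segment (convex_combos _) (isCompact_combos _), hmap, ih l hlen, htl,
        ih _ (by simpa using hlen)]
      have hg : ∀ i, indexSum (v :: l) i = indexSum (Pi.single 0 (d : ℤ) :: l.map A.mulVec) i :=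
        fun i => by rw [← hAv, ← List.map_cons, indexSum_map A B hAB]
      simp only [hg]
      rw [Finset.sum_range_succ' _ (m + 1), Finset.sum_range_succ' _ (m + 1)]
      simp only [indexSum_single_cons_succ (Int.natCast_ne_zero.2 hd), indexSum_zero,
        indexSum_map A B hAB, Int.natAbs_natCast, Finset.mul_sum, add_mul, Finset.sum_add_distrib]
      have : ∀ i, d * k * (indexSum ((l.map A.mulVec).map Fin.tail) i * k ^ i) =
          d * indexSum ((l.map A.mulVec).map Fin.tail) i * k ^ (i + 1) := fun i => by ring
      simp only [this]
      ring

end Count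

/-! ### Coefficients, spans and differences -/

section Combos

variable {E : Type*} [AddCommGroup E] [Module ℝ E] {a b : ℝ}

theorem mem_combos_ofFn {m : ℕ} {v : Fin m → E} {x : E} :
    x ∈ combos a b (List.ofFn v) ↔
      ∃ α : Fin m → ℝ, (∀ k, a ≤ α k ∧ α k ≤ b) ∧ x = ∑ k, α k • v k := by
  induction m generalizing x with
  | zero => simp [combos]
  | succ m ih =>
    simp only [List.ofFn_succ, combos, Set.mem_ofPred_eq, ih]
    constructor
    · rintro ⟨c, hc, _, ⟨α, hα, rfl⟩, rfl⟩
      refine ⟨Fin.cons c α, fun k => ?_, by simp [Fin.sum_univ_succ]⟩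
      refine Fin.cases ?_ (fun k => ?_) k
      · simpa using hc
      · simpa using hα k
    · rintro ⟨α, hα, rfl⟩
      exact ⟨α 0, hα 0, _, ⟨fun k => α k.succ, fun k => hα _, rfl⟩, Fin.sum_univ_succ _⟩

theorem combos_subset_span (l : List E) :
    combos a b l ⊆ Submodule.span ℝ {v | v ∈ l} := by
  induction l with
  | nil => rintro _ rfl; exact zero_mem _
  | cons v l ih =>
    rintro _ ⟨c, -, y, hy, rfl⟩
    refine add_mem (Submodule.smul_mem _ _ (Submodule.subset_span (by simp))) ?_
    exact Submodule.span_mono (fun w hw => List.mem_cons_of_mem _ hw) (ih hy)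

theorem zero_mem_combos (l : List E) (h : (0 : ℝ) ∈ Set.Icc a b) : 0 ∈ combos a b l := by
  induction l with
  | nil => rfl
  | cons v l ih => exact ⟨0, h, 0, ih, by simp⟩

theorem mem_combos_of_mem {l : List E} {v : E} (hv : v ∈ l) : v ∈ combos 0 1 l := by
  induction l with
  | nil => simp at hv
  | cons w l ih =>
    rcases List.mem_cons.1 hv with rfl | hv
    · exact ⟨1, by simp, 0, zero_mem_combos _ (by simp), by simp⟩
    · exact ⟨0, by simp, v, ih hv, by simp⟩

theorem sub_mem_combos {l : List E} {x y : E} (hx : x ∈ combos 0 1 l) (hy : y ∈ combos 0 1 l) :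
    x - y ∈ combos (-1) 1 l := by
  induction l generalizing x y with
  | nil =>
    obtain rfl : x = 0 := hx
    obtain rfl : y = 0 := hy
    simp [combos]
  | cons v l ih =>
    obtain ⟨c, hc, x, hx, rfl⟩ := hx
    obtain ⟨d, hd, y, hy, rfl⟩ := hy
    refine ⟨c - d, ⟨by linarith [hc.1, hd.2], by linarith [hc.2, hd.1]⟩, x - y, ih hx hy, ?_⟩
    rw [sub_smul]
    abel

end Combos

/-! ### Ehrhart polynomial and volume of a lattice zonotope -/

section Representation

variable {n : ℕ} {Z : Set (Fin n → ℝ)}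

theorem IsLatticeZonotope.exists_list (hZ : IsLatticeZonotope Z) :
    ∃ (q : Fin n → ℤ) (l : List (Fin n → ℤ)), Z = {intVec q} + combos 0 1 (l.map intVec) := by
  obtain ⟨m, p, v, hp, hv, rfl⟩ := hZ
  choose p' hp' using hp
  choose v' hv' using hv
  refine ⟨∑ k, p' k, List.ofFn v', ?_⟩
  have hq : intVec (∑ k, p' k) = ∑ k, p k := by
    ext j
    simp [intVec, ← hp']
  have hv2 : (List.ofFn v').map intVec = List.ofFn v := by
    rw [List.map_ofFn]
    congr 1
    exact funext hv'
  ext x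
  simp only [Set.singleton_add, Set.mem_image, hq, hv2, mem_combos_ofFn, Set.mem_ofPred_eq,
    Finset.sum_add_distrib]
  constructor
  · rintro ⟨α, hα, rfl⟩
    exact ⟨_, ⟨α, hα, rfl⟩, rfl⟩
  · rintro ⟨_, ⟨α, hα, rfl⟩, rfl⟩
    exact ⟨α, hα, rfl⟩

variable {q : Fin n → ℤ} {l : List (Fin n → ℤ)}

theorem convex_zonotope (hZ : Z = {intVec q} + combos 0 1 (l.map intVec)) : Convex ℝ Z :=
  hZ ▸ (convex_singleton _).add (convex_combos _)

theorem isCompact_zonotope (hZ : Z = {intVec q} + combos 0 1 (l.map intVec)) : IsCompact Z :=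
  hZ ▸ isCompact_singleton.add (isCompact_combos _)

theorem latticePointCount_smul (hZ : Z = {intVec q} + combos 0 1 (l.map intVec)) (k : ℕ) :
    latticePointCount ((k : ℝ) • Z) = ∑ i ∈ Finset.range (n + 1), indexSum l i * k ^ i := by
  rw [latticePointCount_eq, ← ncard_combos, hZ, smul_add, smul_combos (by positivity) zero_le_one,
    mul_zero, mul_one]
  have : intVec ⁻¹' ((k : ℝ) • {intVec q} + combos 0 (k : ℝ) (l.map intVec)) =
      (fun z => (k : ℤ) • q + z) '' (intVec ⁻¹' combos 0 (k : ℝ) (l.map intVec)) := by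
    have h : ∀ z, intVec ((k : ℤ) • q + z) = (k : ℝ) • intVec q + intVec z := fun z => by
      ext j
      simp [intVec]
    ext z
    simp only [Set.smul_set_singleton, Set.singleton_add, Set.mem_preimage, Set.mem_image]
    constructor
    · rintro ⟨y, hy, hz⟩
      refine ⟨z - (k : ℤ) • q, ?_, by simp⟩
      have : intVec (z - (k : ℤ) • q) = y := by
        have := h (z - (k : ℤ) • q)
        rw [add_sub_cancel, ← hz] at this
        exact (add_left_cancel this).symm
      rwa [this]
    · rintro ⟨y, hy, rfl⟩
      exact ⟨_, hy, (h y).symm⟩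
  rw [this, Set.ncard_image_of_injective _ (add_right_injective _)]

theorem isEhrhartPolynomial_indexSum (hZ : Z = {intVec q} + combos 0 1 (l.map intVec)) :
    IsEhrhartPolynomial Z
      (∑ i ∈ Finset.range (n + 1), Polynomial.monomial i (indexSum l i : ℝ)) := by
  constructor
  · refine Polynomial.natDegree_sum_le_of_forall_le _ _ fun i hi => ?_
    exact (Polynomial.natDegree_monomial_le _).trans (by simpa [Nat.lt_succ_iff] using hi)
  · intro k
    rw [latticePointCount_smul hZ, Polynomial.eval_finsetSum]
    simp

theorem ehrhartCoeff_eq (hZ : Z = {intVec q} + combos 0 1 (l.map intVec)) {i : ℕ} (hi : i ≤ n) :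
    ehrhartCoeff Z i = indexSum l i := by
  have h : ∃ r, IsEhrhartPolynomial Z r := ⟨_, isEhrhartPolynomial_indexSum hZ⟩
  rw [ehrhartCoeff, dif_pos h, h.choose_spec.unique (isEhrhartPolynomial_indexSum hZ),
    Polynomial.finsetSum_coeff]
  simp [Polynomial.coeff_monomial, hi]

/-- Both sides are the limit of the number of lattice points of `kZ` divided by `k ^ n`: one by
Riemann sums, using that a convex set has null boundary, the other by the Ehrhart polynomial. -/
theorem vol_eq (hZ : Z = {intVec q} + combos 0 1 (l.map intVec)) : vol Z = indexSum l n := by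
  have hc := isCompact_zonotope hZ
  have h1 := tendsto_card_div_pow_atTop_volume Z hc.isBounded hc.measurableSet
    ((convex_zonotope hZ).addHaar_frontier _)
  have h2 : Filter.Tendsto (fun k : ℕ => ∑ i ∈ Finset.range (n + 1),
      (indexSum l i : ℝ) * ((k : ℝ) ^ i / (k : ℝ) ^ n)) Filter.atTop (nhds (indexSum l n : ℝ)) := by
    rw [show (nhds (indexSum l n : ℝ)) = nhds (∑ i ∈ Finset.range (n + 1),
      (indexSum l i : ℝ) * if i = n then 1 else 0) by simp]
    refine tendsto_finsetSum _ fun i hi => Filter.Tendsto.const_mul _ ?_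
    split_ifs with h
    · subst h
      refine tendsto_const_nhds.congr' ?_
      filter_upwards [Filter.eventually_gt_atTop 0] with k hk
      rw [div_self (by positivity)]
    · have : i < n := lt_of_le_of_ne (by simpa [Nat.lt_succ_iff] using hi) h
      exact (tendsto_pow_div_pow_atTop_zero this).comp tendsto_natCast_atTop_atTop
  refine tendsto_nhds_unique (h1.congr' ?_) h2
  filter_upwards [Filter.eventually_gt_atTop 0] with k hk
  have hk' : (k : ℝ) ≠ 0 := by positivity
  have hcount : Nat.card ↑(Z ∩ (k : ℝ)⁻¹ •
      (Submodule.span ℤ (Set.range (Pi.basisFun ℝ (Fin n))) : Set (Fin n → ℝ))) =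
      latticePointCount ((k : ℝ) • Z) := by
    rw [Nat.card_coe_set_eq, latticePointCount,
      ← Set.ncard_image_of_injective _ (smul_right_injective (Fin n → ℝ) hk')]
    congr 1
    ext x
    simp only [Set.mem_image, Set.mem_inter_iff, Set.mem_smul_set]
    have hL : ∀ y : Fin n → ℝ,
        y ∈ (Submodule.span ℤ (Set.range (Pi.basisFun ℝ (Fin n))) : Set (Fin n → ℝ)) ↔
          y ∈ intLattice n := by
      intro y
      rw [SetLike.mem_coe, Module.Basis.mem_span_iff_repr_mem]
      constructor
      · intro h
        choose z hz using h
        exact ⟨z, funext fun j => by simpa using hz j⟩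
      · rintro ⟨z, rfl⟩ j
        exact ⟨z j, by simp⟩
    constructor
    · rintro ⟨_, ⟨h, y, hy, rfl⟩, rfl⟩
      refine ⟨⟨_, h, rfl⟩, ?_⟩
      simp only [smul_inv_smul₀ hk']
      exact (hL y).1 hy
    · rintro ⟨⟨y, hy, rfl⟩, h⟩
      exact ⟨y, ⟨hy, (k : ℝ) • y, (hL _).2 h, inv_smul_smul₀ hk' y⟩, rfl⟩
  rw [hcount, latticePointCount_smul hZ, Nat.cast_sum, Finset.sum_div, Fintype.card_fin]
  refine Finset.sum_congr rfl fun i _ => ?_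
  push_cast
  rw [mul_div_assoc]

theorem differenceBody_subset (hZ : Z = {intVec q} + combos 0 1 (l.map intVec)) :
    differenceBody Z ⊆ combos (-1) 1 (l.map intVec) := by
  subst hZ
  rintro _ ⟨_, ⟨_, rfl, x, hx, rfl⟩, _, ⟨_, rfl, y, hy, rfl⟩, rfl⟩
  simpa using sub_mem_combos hx hy

theorem smul_differenceBody_subset (hZ : Z = {intVec q} + combos 0 1 (l.map intVec)) {t : ℝ}
    (ht : 0 ≤ t) : t • differenceBody Z ⊆ combos (-t) t (l.map intVec) := by
  refine (Set.smul_set_mono (differenceBody_subset hZ)).trans ?_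
  rw [smul_combos ht (by norm_num), mul_neg, mul_one]

theorem intVec_mem_differenceBody (hZ : Z = {intVec q} + combos 0 1 (l.map intVec))
    {v : Fin n → ℤ} (hv : v ∈ l) : intVec v ∈ differenceBody Z := by
  subst hZ
  refine ⟨_, ⟨_, rfl, intVec v, mem_combos_of_mem (List.mem_map_of_mem hv), rfl⟩,
    _, ⟨_, rfl, 0, zero_mem_combos _ (by simp), rfl⟩, ?_⟩
  simp

theorem span_generators_eq_top (hZ : Z = {intVec q} + combos 0 1 (l.map intVec))
    (hdim : affineDim Z = n) : Submodule.span ℝ {w | w ∈ l.map intVec} = ⊤ := by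
  have htop : vectorSpan ℝ Z = ⊤ := Submodule.eq_top_of_finrank_eq
    (Eq.trans (show Module.finrank ℝ (vectorSpan ℝ Z) = n from hdim) (by simp))
  rw [eq_top_iff, ← htop]
  refine Submodule.span_le.2 ?_
  exact (differenceBody_subset hZ).trans (combos_subset_span _)

end Representation

/-! ### Successive minima of the difference body -/

section SuccessiveMin

variable {n : ℕ} {Z : Set (Fin n → ℝ)} {q : Fin n → ℤ} {l : List (Fin n → ℤ)}

theorem zero_mem_intLattice : (0 : Fin n → ℝ) ∈ intLattice n := ⟨0, by ext; simp⟩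

theorem zero_mem_differenceBody (hZ : Z = {intVec q} + combos 0 1 (l.map intVec)) :
    0 ∈ differenceBody Z := by
  have h : intVec q ∈ Z := by
    rw [hZ]
    exact ⟨_, rfl, 0, zero_mem_combos _ (by simp), by simp⟩
  exact ⟨_, h, _, h, by simp⟩

theorem vectorSpan_eq_span {S : Set (Fin n → ℝ)} (h : 0 ∈ S) :
    vectorSpan ℝ S = Submodule.span ℝ S := by
  rw [vectorSpan_eq_span_vsub_set_right ℝ h]
  simp

theorem affineDim_smul_differenceBody (hZ : Z = {intVec q} + combos 0 1 (l.map intVec)) (t : ℝ) :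
    affineDim ((t • differenceBody Z) ∩ intLattice n) =
      Module.finrank ℝ (Submodule.span ℝ ((t • differenceBody Z) ∩ intLattice n)) := by
  rw [affineDim, vectorSpan_eq_span]
  exact ⟨⟨0, zero_mem_differenceBody hZ, by simp⟩, zero_mem_intLattice⟩

theorem bddBelow_successiveMin (K : Set (Fin n → ℝ)) (i : ℕ) :
    BddBelow {t : ℝ | 0 < t ∧ i ≤ affineDim ((t • K) ∩ intLattice n)} :=
  ⟨0, fun _ h => h.1.le⟩

/-- The generators are lattice points of `DZ` and span. Hence the infimum defining each `λ_i` with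
`i ≤ n` is over a nonempty set. -/
theorem one_mem_successiveMin (hZ : Z = {intVec q} + combos 0 1 (l.map intVec))
    (hdim : affineDim Z = n) {i : ℕ} (hi : i ≤ n) :
    (1 : ℝ) ∈ {t : ℝ | 0 < t ∧ i ≤ affineDim ((t • differenceBody Z) ∩ intLattice n)} := by
  refine ⟨one_pos, hi.trans ?_⟩
  rw [affineDim_smul_differenceBody hZ, one_smul]
  have : Submodule.span ℝ (differenceBody Z ∩ intLattice n) = ⊤ := by
    rw [eq_top_iff, ← span_generators_eq_top hZ hdim]
    refine Submodule.span_mono fun w hw => ?_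
    obtain ⟨v, hv, rfl⟩ := List.mem_map.1 hw
    exact ⟨intVec_mem_differenceBody hZ hv, v, rfl⟩
  rw [this]
  simp

theorem successiveMin_nonneg (K : Set (Fin n → ℝ)) (i : ℕ) : 0 ≤ successiveMin K i :=
  Real.sInf_nonneg fun _ h => h.1.le

theorem successiveMin_mono (hZ : Z = {intVec q} + combos 0 1 (l.map intVec))
    (hdim : affineDim Z = n) {i j : ℕ} (hij : i ≤ j) (hj : j ≤ n) :
    successiveMin (differenceBody Z) i ≤ successiveMin (differenceBody Z) j :=
  csInf_le_csInf (bddBelow_successiveMin _ _) ⟨1, one_mem_successiveMin hZ hdim hj⟩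
    fun _ h => ⟨h.1, hij.trans h.2⟩

theorem affineDim_lt_of_lt_successiveMin {K : Set (Fin n → ℝ)} {i : ℕ} {t : ℝ} (ht : 0 < t)
    (h : t < successiveMin K i) : affineDim ((t • K) ∩ intLattice n) < i := by
  by_contra! H
  exact h.not_ge (csInf_le (bddBelow_successiveMin _ _) ⟨ht, H⟩)

theorem exists_lt_of_successiveMin_lt (hZ : Z = {intVec q} + combos 0 1 (l.map intVec))
    (hdim : affineDim Z = n) {i : ℕ} (hi : i ≤ n) {s : ℝ}
    (h : successiveMin (differenceBody Z) i < s) :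
    ∃ t, 0 < t ∧ t < s ∧ i ≤ affineDim ((t • differenceBody Z) ∩ intLattice n) := by
  obtain ⟨t, ht, hts⟩ := exists_lt_of_csInf_lt ⟨1, one_mem_successiveMin hZ hdim hi⟩ h
  exact ⟨t, ht.1, hts, ht.2⟩

end SuccessiveMin

/-! ### Completing by short lattice vectors: the first inequality -/

section Independence

variable {n : ℕ}

theorem detList_ne_zero_of_linearIndependent {X : List (Fin n → ℝ)} (hlen : X.length = n)
    (h : LinearIndependent ℝ X.get) : detList X ≠ 0 := by
  unfold detList
  rw [if_pos hlen]
  have h1 : LinearIndependent ℝ (Matrix.of fun i : Fin n => X.getD i 0).row := by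
    have := h.comp (Fin.cast hlen.symm) (Fin.cast_injective _)
    convert this using 1
    ext i j
    simp [Matrix.row, hlen]
  rw [Matrix.linearIndependent_rows_iff_isUnit, Matrix.isUnit_iff_isUnit_det] at h1
  exact h1.ne_zero

theorem linearIndependent_of_detList_ne_zero {X a : List (Fin n → ℝ)}
    (h : detList (X ++ a) ≠ 0) : LinearIndependent ℝ X.get := by
  unfold detList at h
  split_ifs at h with hlen
  · have h1 := (Matrix.isUnit_iff_isUnit_det _).2 h.isUnit
    rw [← Matrix.linearIndependent_rows_iff_isUnit] at h1
    have hle : X.length ≤ n := by rw [List.length_append] at hlen; omega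
    have h2 := h1.comp (Fin.castLE hle) (Fin.castLE_injective _)
    have e : X.get = (Matrix.of fun i : Fin n => (X ++ a).getD i 0).row ∘ Fin.castLE hle := by
      ext i j
      change X[(i : ℕ)] j = (X ++ a).getD i 0 j
      rw [List.getD_append _ _ _ _ i.2]
      simp
    rw [e]
    exact h2
  · exact absurd rfl h

theorem linearIndependent_get_cons {E : Type*} [AddCommGroup E] [Module ℝ E] {X : List E} {w : E}
    (h : LinearIndependent ℝ X.get) (hw : w ∉ Submodule.span ℝ (Set.range X.get)) :
    LinearIndependent ℝ (w :: X).get := by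
  have : (w :: X).get = (Fin.cons w X.get : Fin (X.length + 1) → E) := by
    funext i
    exact Fin.cases rfl (fun _ => rfl) i
  rw [this]
  exact linearIndependent_finCons.2 ⟨h, hw⟩

theorem detList_map_intVec (L : List (Fin n → ℤ)) :
    detList (L.map intVec) = ((detList L : ℤ) : ℝ) :=
  detList_map_ringHom (Int.castRingHom ℝ) L

/-- Greedy choice: lattice points of `t DZ` with `t < λ_(|X|+1) + ε` span more than `|X|`
dimensions, so one of them lies outside the span of `X`. The slack `ε` avoids proving that the
minima are attained. -/
theorem exists_completion {Z : Set (Fin n → ℝ)} {q : Fin n → ℤ} {l : List (Fin n → ℤ)}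
    (hZ : Z = {intVec q} + combos 0 1 (l.map intVec)) (hdim : affineDim Z = n) {ε : ℝ} (hε : 0 < ε)
    (r : ℕ) (X : List (Fin n → ℝ)) (hX : X.length + r = n) (hind : LinearIndependent ℝ X.get) :
    ∃ ws : List ((Fin n → ℤ) × ℝ), ws.length = r ∧
      (∀ w ∈ ws, 0 ≤ w.2 ∧ intVec w.1 ∈ combos (-w.2) w.2 (l.map intVec)) ∧
      (ws.map Prod.snd).prod ≤
        ∏ j ∈ Finset.Icc (X.length + 1) n, (successiveMin (differenceBody Z) j + ε) ∧
      detList ((ws.map fun w => intVec w.1) ++ X) ≠ 0 := by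
  induction r generalizing X with
  | zero =>
    refine ⟨[], rfl, by simp, ?_, ?_⟩
    · rw [Finset.Icc_eq_empty (by omega)]
      simp
    · exact detList_ne_zero_of_linearIndependent hX hind
  | succ r ih =>
    obtain ⟨t, ht0, hts, hdimt⟩ := exists_lt_of_successiveMin_lt hZ hdim
      (i := X.length + 1) (by omega) (lt_add_of_pos_right _ hε)
    rw [affineDim_smul_differenceBody hZ] at hdimt
    obtain ⟨_, ⟨hwK, z, rfl⟩, hw⟩ : ∃ w ∈ (t • differenceBody Z) ∩ intLattice n,
        w ∉ Submodule.span ℝ (Set.range X.get) := by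
      by_contra! H
      have h1 := Submodule.finrank_mono (Submodule.span_le.2 H)
      have h2 := finrank_range_le_card (R := ℝ) X.get
      rw [Set.finrank, Fintype.card_fin] at h2
      omega
    obtain ⟨ws, hlen, hmem, hprod, hdet⟩ := ih (intVec z :: X) (by simp; omega)
      (linearIndependent_get_cons hind hw)
    refine ⟨ws ++ [(z, t)], by simp [hlen], ?_, ?_, ?_⟩
    · intro w hw
      rcases List.mem_append.1 hw with hw | hw
      · exact hmem w hw
      · obtain rfl := List.mem_singleton.1 hw
        exact ⟨ht0.le, smul_differenceBody_subset hZ ht0.le hwK⟩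
    · rw [List.map_append, List.prod_append, mul_comm,
        ← Finset.insert_Icc_add_one_left_eq_Icc (show X.length + 1 ≤ n by omega),
        Finset.prod_insert (by simp)]
      refine mul_le_mul (by simpa using hts.le) hprod ?_ ?_
      · refine List.prod_nonneg fun a ha => ?_
        obtain ⟨w, hw, rfl⟩ := List.mem_map.1 ha
        exact (hmem w hw).1
      · exact add_nonneg (successiveMin_nonneg _ _) hε.le
    · simpa using hdet

theorem tupleSum_nonneg {E : Type*} {l : List E} {F : List E → ℝ} (hF : ∀ L, 0 ≤ F L) (r : ℕ)
    (X : List E) : 0 ≤ tupleSum l F r X := by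
  induction r generalizing X with
  | zero => exact hF X
  | succ r ih =>
    refine List.sum_nonneg fun x hx => ?_
    obtain ⟨v, -, rfl⟩ := List.mem_map.1 hx
    exact ih _

/-- Bounds each index by a completed determinant, expands the completion in generators, and sums
over `X` by double counting. -/
theorem indexSum_le_add {Z : Set (Fin n → ℝ)} {q : Fin n → ℤ} {l : List (Fin n → ℤ)}
    (hZ : Z = {intVec q} + combos 0 1 (l.map intVec)) (hdim : affineDim Z = n) {ε : ℝ} (hε : 0 < ε)
    {i : ℕ} (hi : i ≤ n) :
    (indexSum l i : ℝ) ≤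
      (∏ j ∈ Finset.Icc (i + 1) n, (successiveMin (differenceBody Z) j + ε)) *
        ((n.factorial / i.factorial : ℝ) * indexSum l n) := by
  set P := ∏ j ∈ Finset.Icc (i + 1) n, (successiveMin (differenceBody Z) j + ε) with hP
  have hP0 : 0 ≤ P :=
    Finset.prod_nonneg fun j _ => add_nonneg (successiveMin_nonneg _ _) hε.le
  set T := tupleSum (l.map intVec) (fun L => |detList L|) (n - i) with hT
  have hT0 : ∀ X, 0 ≤ T X := tupleSum_nonneg (fun L => abs_nonneg _) _
  have hX : ∀ X ∈ l.sublistsLen i, (latticeIndex X : ℝ) ≤ P * T (X.map intVec) := by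
    intro X hX
    have hlen : X.length = i := List.length_of_sublistsLen hX
    by_cases h0 : latticeIndex X = 0
    · rw [h0, Nat.cast_zero]
      exact mul_nonneg hP0 (hT0 _)
    obtain ⟨a, ha⟩ := exists_of_latticeIndex_ne_zero h0
    have hind : LinearIndependent ℝ (X.map intVec).get := by
      refine linearIndependent_of_detList_ne_zero (a := a.map intVec) ?_
      rw [← List.map_append, detList_map_intVec]
      exact_mod_cast ha
    obtain ⟨ws, hwlen, hmem, hprod, hdet⟩ := exists_completion hZ hdim hε (n - i) _
      (by rw [List.length_map]; omega) hind
    have hperm : |detList (X ++ ws.map Prod.fst)| = |detList (ws.map Prod.fst ++ X)| :=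
      abs_detList_perm List.perm_append_comm
    have hcast : detList ((ws.map fun w => intVec w.1) ++ X.map intVec) =
        ((detList (ws.map Prod.fst ++ X) : ℤ) : ℝ) := by
      rw [← detList_map_intVec, List.map_append, List.map_map]
      rfl
    have h1 : (latticeIndex X : ℝ) ≤ |detList ((ws.map fun w => intVec w.1) ++ X.map intVec)| := by
      have hne : detList (X ++ ws.map Prod.fst) ≠ 0 := by
        rw [← abs_ne_zero, hperm, abs_ne_zero]
        intro h
        rw [hcast, h] at hdet
        simp at hdet
      have := latticeIndex_le X _ hne
      rw [hcast, ← Int.cast_abs, ← hperm, Int.abs_eq_natAbs]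
      exact_mod_cast this
    have h2 := abs_detList_append_le (l := l.map intVec) (ws.map fun w => (intVec w.1, w.2))
      (List.forall_mem_map.2 fun w hw => (hmem w hw).1)
      (List.forall_mem_map.2 fun w hw => (hmem w hw).2) (X.map intVec)
    simp only [List.map_map, List.length_map, hwlen, Function.comp_def] at h2
    rw [List.length_map, hlen] at hprod
    exact h1.trans (h2.trans (mul_le_mul_of_nonneg_right hprod (hT0 _)))
  have hsum := sum_sublistsLen_tupleSum (l := l.map intVec) (F := fun L => |detList L|)
    (fun L L' h => abs_detList_perm h) (fun x L => by simp [detList_cons_cons_self]) (n - i) i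
  rw [Nat.add_sub_cancel' hi, ← hT] at hsum
  have htop : (((l.map intVec).sublistsLen n).map fun L => |detList L|).sum =
      (indexSum l n : ℝ) := by
    rw [indexSum, sublistsLen_map, List.map_map, Nat.cast_list_sum, List.map_map]
    congr 1
    refine List.map_congr_left fun X hX => ?_
    simp only [Function.comp_apply]
    rw [detList_map_intVec, latticeIndex_of_length_eq (List.length_of_sublistsLen hX),
      Nat.cast_natAbs, Int.cast_abs]
  rw [← htop, ← hsum, sublistsLen_map, List.map_map, indexSum, Nat.cast_list_sum, List.map_map,
    ← List.sum_map_mul_left]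
  exact List.sum_le_sum fun X h => hX X h

theorem indexSum_le {Z : Set (Fin n → ℝ)} {q : Fin n → ℤ} {l : List (Fin n → ℤ)}
    (hZ : Z = {intVec q} + combos 0 1 (l.map intVec)) (hdim : affineDim Z = n)
    {i : ℕ} (hi : i ≤ n) :
    (indexSum l i : ℝ) ≤
      (∏ j ∈ Finset.Icc (i + 1) n, successiveMin (differenceBody Z) j) *
        ((n.factorial / i.factorial : ℝ) * indexSum l n) := by
  have h : Filter.Tendsto (fun ε : ℝ =>
      (∏ j ∈ Finset.Icc (i + 1) n, (successiveMin (differenceBody Z) j + ε)) *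
        ((n.factorial / i.factorial : ℝ) * indexSum l n)) (nhdsWithin 0 (Set.Ioi 0))
      (nhds ((∏ j ∈ Finset.Icc (i + 1) n, (successiveMin (differenceBody Z) j + 0)) *
        ((n.factorial / i.factorial : ℝ) * indexSum l n))) := by
    refine Filter.Tendsto.mono_left ?_ nhdsWithin_le_nhds
    refine Continuous.tendsto (f := fun ε : ℝ =>
      (∏ j ∈ Finset.Icc (i + 1) n, (successiveMin (differenceBody Z) j + ε)) *
        ((n.factorial / i.factorial : ℝ) * indexSum l n)) ?_ 0
    fun_prop
  simp only [add_zero] at h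
  refine ge_of_tendsto h ?_
  filter_upwards [self_mem_nhdsWithin] with ε hε
  exact indexSum_le_add hZ hdim hε hi

end Independence

/-! ### Volume in a quotient by translations -/

section QuotientVolume

open MeasureTheory Set
open scoped ENNReal

variable {ι E : Type*} [AddCommGroup ι] [AddCommGroup E]

/-- The number of `z : ι` with `x + f z ∈ S`. -/
def translateCount (f : ι →+ E) (S : Set E) (x : E) : ℝ≥0∞ :=
  ∑' z : ι, S.indicator (fun _ => 1) (x + f z)

/-- The weight `1 / #{z | x + f z ∈ S}` on `S`, extended by `0`. -/
def quotientWeight (f : ι →+ E) (S : Set E) : E → ℝ≥0∞ :=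
  S.indicator fun x => (translateCount f S x)⁻¹

/-- The volume of the image of `S` in the quotient of `E` by the range of `f`. -/
def quotientVolume [MeasurableSpace E] (μ : Measure E) (f : ι →+ E) (S : Set E) : ℝ≥0∞ :=
  ∫⁻ x, quotientWeight f S x ∂μ

theorem translateCount_add (f : ι →+ E) (S : Set E) (x : E) (z : ι) :
    translateCount f S (x + f z) = translateCount f S x := by
  refine Eq.trans (tsum_congr fun c => ?_)
    ((Equiv.addLeft z).tsum_eq fun c => S.indicator (fun _ => (1 : ℝ≥0∞)) (x + f c))
  rw [Equiv.coe_addLeft, map_add, add_assoc]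

theorem translateCount_lt_top {f : ι →+ E} {S : Set E} {x : E}
    (h : {z | x + f z ∈ S}.Finite) : translateCount f S x < ∞ := by
  unfold translateCount
  rw [tsum_eq_sum (s := h.toFinset)
    (fun z hz => indicator_of_notMem (by simpa using hz) _)]
  refine ENNReal.sum_lt_top.2 fun z _ => ?_
  exact (indicator_le_self' (fun _ _ => zero_le) _).trans_lt ENNReal.one_lt_top

theorem one_le_translateCount {f : ι →+ E} {S : Set E} {x : E} {z : ι} (h : x + f z ∈ S) :
    1 ≤ translateCount f S x := by
  refine le_trans ?_ (ENNReal.le_tsum z)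
  rw [indicator_of_mem h]

variable [MeasurableSpace E]

theorem quotientVolume_eq_measure (μ : Measure E) (f : ι →+ E) {S : Set E}
    (hS : MeasurableSet S) (h : ∀ x ∈ S, translateCount f S x = 1) :
    quotientVolume μ f S = μ S := by
  rw [← lintegral_indicator_one hS]
  refine lintegral_congr fun x => ?_
  by_cases hx : x ∈ S
  · simp [quotientWeight, hx, h]
  · simp [quotientWeight, hx]

theorem quotientVolume_smul_measure (μ : Measure E) (c : NNReal) (f : ι →+ E) (S : Set E) :
    quotientVolume (c • μ) f S = c * quotientVolume μ f S := by
  unfold quotientVolume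
  rw [lintegral_smul_measure]
  rfl

theorem quotientVolume_map {E' : Type*} [AddCommGroup E'] [MeasurableSpace E'] (μ : Measure E)
    (e : E ≃+ E') (he : Measurable e) (he' : Measurable e.symm) (f : ι →+ E) (S : Set E) :
    quotientVolume (μ.map e) ((e : E →+ E').comp f) (e '' S) = quotientVolume μ f S := by
  let e' : E ≃ᵐ E' := ⟨e.toEquiv, he, he'⟩
  have h : ∀ x, e x ∈ e '' S ↔ x ∈ S := fun x => e.injective.mem_set_image
  have h1 : ∀ x, translateCount ((e : E →+ E').comp f) (e '' S) (e x) = translateCount f S x := by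
    intro x
    unfold translateCount
    congr 1
    ext z
    have : e x + ((e : E →+ E').comp f) z = e (x + f z) := by simp
    rw [this]
    by_cases hx : x + f z ∈ S
    · rw [indicator_of_mem hx, indicator_of_mem ((h _).2 hx)]
    · rw [indicator_of_notMem hx, indicator_of_notMem (mt (h _).1 hx)]
  unfold quotientVolume
  refine (lintegral_map_equiv _ e').trans (lintegral_congr fun x => ?_)
  change quotientWeight _ _ (e x) = _
  unfold quotientWeight
  by_cases hx : x ∈ S
  · rw [indicator_of_mem hx, indicator_of_mem ((h _).2 hx), h1]
  · rw [indicator_of_notMem hx, indicator_of_notMem (mt (h _).1 hx)]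

variable [MeasurableAdd E]

theorem measurable_translateCount [Countable ι] (f : ι →+ E) {S : Set E} (hS : MeasurableSet S) :
    Measurable (translateCount f S) := by
  unfold translateCount
  refine Measurable.tsum fun z => ?_
  exact (measurable_const.indicator hS).comp (measurable_add_const (f z))

theorem measurable_quotientWeight [Countable ι] (f : ι →+ E) {S : Set E} (hS : MeasurableSet S) :
    Measurable (quotientWeight f S) :=
  (measurable_translateCount f hS).inv.indicator hS

/-- If every point of `C` has a translate in `C'`, then the quotient volume of `C` is at most that
of `C'`. -/
theorem quotientVolume_le [Countable ι] (μ : Measure E) [μ.IsAddRightInvariant] (f : ι →+ E)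
    {C C' : Set E} (hC : MeasurableSet C) (hC' : MeasurableSet C')
    (hfin : ∀ x, translateCount f C' x < ∞) (h : ∀ x ∈ C, ∃ z, x + f z ∈ C') :
    quotientVolume μ f C ≤ quotientVolume μ f C' := by
  have hmC := measurable_translateCount f hC
  have hmC' := measurable_translateCount f hC'
  calc quotientVolume μ f C
      = ∫⁻ x, ∑' z : ι, quotientWeight f C x * (translateCount f C' x)⁻¹ *
          C'.indicator (fun _ => 1) (x + f z) ∂μ := by
        refine lintegral_congr fun x => ?_
        -- For `x ∈ C` the inserted factor sums to `1` over `z`, since some translate of `x` lies in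
        -- `C'`.
        rw [ENNReal.tsum_mul_left, mul_assoc]
        by_cases hx : x ∈ C
        · obtain ⟨z, hz⟩ := h x hx
          have h0 : translateCount f C' x ≠ 0 :=
            (zero_lt_one.trans_le (one_le_translateCount hz)).ne'
          change _ = _ * (_ * translateCount f C' x)
          rw [ENNReal.inv_mul_cancel h0 (hfin x).ne, mul_one]
        · simp [quotientWeight, hx]
    _ = ∑' z : ι, ∫⁻ x, quotientWeight f C x * (translateCount f C' x)⁻¹ *
          C'.indicator (fun _ => 1) (x + f z) ∂μ := by
        refine lintegral_tsum fun z => ?_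
        exact (((measurable_quotientWeight f hC).mul hmC'.inv).mul
          ((measurable_const.indicator hC').comp (measurable_add_const (f z)))).aemeasurable
    _ = ∑' z : ι, ∫⁻ x, quotientWeight f C' x * ((translateCount f C x)⁻¹ *
          C.indicator (fun _ => 1) (x + f (-z))) ∂μ := by
        congr 1
        ext z
        -- Substituting `x - f z` for `x` exchanges the roles of `C` and `C'`; both counts are
        -- periodic.
        rw [← lintegral_add_right_eq_self (μ := μ) _ (f (-z))]
        refine lintegral_congr fun x => ?_
        rw [translateCount_add, add_assoc, ← map_add, neg_add_cancel, map_zero, add_zero]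
        unfold quotientWeight
        by_cases h1 : x ∈ C' <;> by_cases h2 : x + f (-z) ∈ C
        · rw [indicator_of_mem h1, indicator_of_mem h1, indicator_of_mem h2, indicator_of_mem h2,
            translateCount_add, mul_one, mul_one, mul_comm]
        · simp only [indicator_of_notMem h2, mul_zero, zero_mul]
        · simp only [indicator_of_notMem h1, mul_zero, zero_mul]
        · simp only [indicator_of_notMem h1, mul_zero, zero_mul]
    _ = ∫⁻ x, ∑' z : ι, quotientWeight f C' x * ((translateCount f C x)⁻¹ *
          C.indicator (fun _ => 1) (x + f (-z))) ∂μ := by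
        refine (lintegral_tsum fun z => ?_).symm
        exact ((measurable_quotientWeight f hC').mul (hmC.inv.mul
          ((measurable_const.indicator hC).comp (measurable_add_const (f (-z)))))).aemeasurable
    _ ≤ quotientVolume μ f C' := by
        refine lintegral_mono fun x => ?_
        rw [ENNReal.tsum_mul_left, ENNReal.tsum_mul_left]
        have : ∑' z : ι, C.indicator (fun _ => (1 : ℝ≥0∞)) (x + f (-z)) = translateCount f C x :=
          (Equiv.neg ι).tsum_eq fun z => C.indicator (fun _ => (1 : ℝ≥0∞)) (x + f z)
        rw [this]
        exact mul_le_of_le_one_right zero_le (ENNReal.inv_mul_le_one _)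

theorem quotientVolume_preimage_add (μ : Measure E) [μ.IsAddRightInvariant] (f : ι →+ E)
    (S : Set E) (a : E) :
    quotientVolume μ f ((· + a) ⁻¹' S) = quotientVolume μ f S := by
  have h : ∀ x, translateCount f ((· + a) ⁻¹' S) x = translateCount f S (x + a) := fun x => by
    unfold translateCount
    congr 1
    ext z
    rw [add_right_comm]
    rfl
  unfold quotientVolume
  rw [← lintegral_add_right_eq_self (μ := μ) (quotientWeight f S) a]
  refine lintegral_congr fun x => ?_
  unfold quotientWeight
  rw [indicator, indicator]
  simp only [h]
  rfl

end QuotientVolume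

/-! ### Growth of the quotient volume under dilation -/

section Dilation

open MeasureTheory Set Module
open scoped ENNReal

variable {ι : Type*} [AddCommGroup ι] [Countable ι]

theorem quotientVolume_prod {V W : Type*} [AddCommGroup V] [AddCommGroup W]
    [MeasurableSpace V] [MeasurableSpace W] [MeasurableAdd V] [MeasurableAdd W]
    (μ : Measure V) (ν : Measure W) [SFinite μ] [SFinite ν] (f : ι →+ V) {S : Set (V × W)}
    (hS : MeasurableSet S) :
    quotientVolume (μ.prod ν) ((AddMonoidHom.inl V W).comp f) S =
      ∫⁻ w, quotientVolume μ f {v | (v, w) ∈ S} ∂ν := by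
  have : MeasurableAdd (V × W) :=
    ⟨fun c => (measurable_const_add c.1).prodMap (measurable_const_add c.2),
      fun c => (measurable_add_const c.1).prodMap (measurable_add_const c.2)⟩
  unfold quotientVolume
  rw [lintegral_prod_symm' _ (measurable_quotientWeight _ hS)]
  refine lintegral_congr fun w => lintegral_congr fun v => ?_
  have h : translateCount ((AddMonoidHom.inl V W).comp f) S (v, w) =
      translateCount f {v | (v, w) ∈ S} v := by
    unfold translateCount
    congr 1
    ext z
    have : (v, w) + ((AddMonoidHom.inl V W).comp f) z = (v + f z, w) := by simp
    rw [this]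
    rfl
  unfold quotientWeight
  rw [indicator, indicator, h]
  rfl

/-- Translations act only along `V`. By convexity the fibre of `t • S` over `t • w` contains a
translate of the fibre of `S` over `w`, so fibre volumes do not drop, and rescaling `W` yields the
factor `t ^ dim W`. -/
theorem quotientVolume_smul_prod {V W : Type*}
    [NormedAddCommGroup V] [NormedSpace ℝ V] [FiniteDimensional ℝ V] [MeasurableSpace V]
    [BorelSpace V] [NormedAddCommGroup W] [NormedSpace ℝ W] [FiniteDimensional ℝ W]
    [MeasurableSpace W] [BorelSpace W] (μ : Measure V) [μ.IsAddHaarMeasure]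
    (ν : Measure W) [ν.IsAddHaarMeasure] (f : ι →+ V) {S : Set (V × W)} (hconv : Convex ℝ S)
    (hcomp : IsCompact S) (hfin : ∀ K : Set V, IsCompact K → {z | f z ∈ K}.Finite)
    {t : ℝ} (ht : 1 ≤ t) :
    ENNReal.ofReal (t ^ finrank ℝ W) *
        quotientVolume (μ.prod ν) ((AddMonoidHom.inl V W).comp f) S ≤
      quotientVolume (μ.prod ν) ((AddMonoidHom.inl V W).comp f) (t • S) := by
  have ht0 : 0 < t := by linarith
  have hcompt : IsCompact (t • S) := hcomp.smul t
  have hSm := hcomp.measurableSet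
  have hSmt := hcompt.measurableSet
  have hfib : ∀ {K : Set (V × W)}, IsCompact K → ∀ w, IsCompact {v | (v, w) ∈ K} := by
    intro K hK w
    have : {v | (v, w) ∈ K} = Prod.fst '' (K ∩ Prod.snd ⁻¹' {w}) := by
      ext v
      constructor
      · intro h
        exact ⟨(v, w), ⟨h, rfl⟩, rfl⟩
      · rintro ⟨⟨v, w'⟩, ⟨h, rfl⟩, rfl⟩
        exact h
    rw [this]
    exact (hK.inter_right (isClosed_singleton.preimage continuous_snd)).image continuous_fst
  have hfiber : ∀ w, quotientVolume μ f {v | (v, w) ∈ S} ≤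
      quotientVolume μ f {v | (v, t • w) ∈ t • S} := by
    intro w
    have hm' := (hfib hcompt (t • w)).measurableSet
    by_cases hne : {v | (v, w) ∈ S} = ∅
    · rw [hne]
      simp [quotientVolume, quotientWeight]
    obtain ⟨c, hc⟩ := nonempty_iff_ne_empty.2 hne
    rw [← quotientVolume_preimage_add μ f {v | (v, t • w) ∈ t • S} ((t - 1) • c)]
    refine quotientVolume_le μ f (hfib hcomp w).measurableSet (measurable_add_const _ hm') ?_ ?_
    · intro x
      refine translateCount_lt_top ?_
      have := hfin ((fun y => -x + (y + -((t - 1) • c))) '' {v | (v, t • w) ∈ t • S})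
        ((hfib hcompt (t • w)).image (by fun_prop))
      refine this.subset fun z hz => ⟨_, hz, ?_⟩
      simp
    · intro v hv
      refine ⟨0, ?_⟩
      rw [map_zero, add_zero]
      change (v + (t - 1) • c, t • w) ∈ t • S
      -- Dilating this convex combination by `t` gives `(v + (t - 1) c, t w)`.
      refine ⟨t⁻¹ • (v, w) + (1 - t⁻¹) • (c, w), ?_, ?_⟩
      · exact hconv hv hc (by positivity) (sub_nonneg.2 (inv_le_one_of_one_le₀ ht)) (by ring)
      · have h1 : t * (1 - t⁻¹) = t - 1 := by field_simp
        simp only [smul_add, smul_smul, mul_inv_cancel₀ ht0.ne', one_smul, h1]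
        ext
        · rfl
        · simp [sub_smul]
  rw [quotientVolume_prod μ ν f hSm, quotientVolume_prod μ ν f hSmt]
  set F := fun w => quotientVolume μ f {v | (v, w) ∈ t • S} with hF
  calc ENNReal.ofReal (t ^ finrank ℝ W) * ∫⁻ w, quotientVolume μ f {v | (v, w) ∈ S} ∂ν
      ≤ ENNReal.ofReal (t ^ finrank ℝ W) * ∫⁻ w, F (t • w) ∂ν := by
        gcongr with w
        exact hfiber w
    _ = ENNReal.ofReal (t ^ finrank ℝ W) * ∫⁻ w, F w ∂(ν.map (t • ·)) := by
        congr 1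
        exact (lintegral_map_equiv F
          (Homeomorph.smul (Units.mk0 t ht0.ne')).toMeasurableEquiv).symm
    _ = ∫⁻ w, F w ∂ν := by
        rw [Measure.map_addHaar_smul ν ht0.ne', lintegral_smul_measure, smul_eq_mul, ← mul_assoc,
          ← ENNReal.ofReal_mul (by positivity), abs_of_pos (by positivity),
          mul_inv_cancel₀ (by positivity), ENNReal.ofReal_one, one_mul]

/-- Splits off a complement of `L`; by uniqueness of Haar measure the transported measure is a
multiple of a product measure, and the multiple cancels. -/
theorem quotientVolume_smul {E : Type*} [NormedAddCommGroup E] [NormedSpace ℝ E]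
    [FiniteDimensional ℝ E] [MeasurableSpace E] [BorelSpace E] (μ : Measure E)
    [μ.IsAddHaarMeasure] (L : Submodule ℝ E) (f : ι →+ E) (hf : ∀ z, f z ∈ L) {S : Set E}
    (hconv : Convex ℝ S) (hcomp : IsCompact S)
    (hfin : ∀ K : Set E, IsCompact K → {z | f z ∈ K}.Finite) {t : ℝ} (ht : 1 ≤ t) :
    ENNReal.ofReal (t ^ (finrank ℝ E - finrank ℝ L)) * quotientVolume μ f S ≤
      quotientVolume μ f (t • S) := by
  obtain ⟨L', hL'⟩ := L.exists_isCompl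
  let e : E ≃L[ℝ] L × L' := (L.prodEquivOfIsCompl L' hL').symm.toContinuousLinearEquiv
  let fL : ι →+ L := f.codRestrict L hf
  have hfe : ((e.toLinearEquiv.toAddEquiv : E ≃+ L × L') : E →+ L × L').comp f =
      (AddMonoidHom.inl L L').comp fL := by
    ext1 z
    exact Submodule.prodEquivOfIsCompl_symm_apply_left L L' hL' ⟨f z, hf z⟩
  have key : ∀ K : Set E, quotientVolume μ f K =
      quotientVolume (μ.map e) ((AddMonoidHom.inl L L').comp fL) (e '' K) := by
    intro K
    rw [← hfe]
    exact (quotientVolume_map μ e.toLinearEquiv.toAddEquiv e.continuous.measurable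
      e.symm.continuous.measurable f K).symm
  have hdim : finrank ℝ E - finrank ℝ L = finrank ℝ L' := by
    rw [← Submodule.finrank_add_eq_of_isCompl hL', Nat.add_sub_cancel_left]
  rw [key, key, hdim, image_smul_set,
    Measure.isAddLeftInvariant_eq_smul (μ.map e) ((Measure.addHaar : Measure L).prod Measure.addHaar),
    quotientVolume_smul_measure, quotientVolume_smul_measure, mul_left_comm]
  gcongr
  refine quotientVolume_smul_prod _ _ fL (hconv.is_linear_image ⟨e.map_add, e.map_smul⟩)
    (hcomp.image e.continuous) ?_ ht
  intro K hK
  refine (hfin _ (hK.image continuous_subtype_val)).subset fun z hz => ?_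
  exact ⟨_, hz, rfl⟩

end Dilation

/-! ### Minkowski's second theorem through the torus -/

section Minkowski

open MeasureTheory Set Module
open scoped ENNReal

variable {n : ℕ}

/-- The embedding of `ℤⁿ` in `ℝⁿ` as a homomorphism. -/
def intVecHom (n : ℕ) : (Fin n → ℤ) →+ (Fin n → ℝ) where
  toFun := intVec
  map_zero' := by ext; simp [intVec]
  map_add' x y := by ext; simp [intVec]

theorem finite_intVec_add {K : Set (Fin n → ℝ)} (hK : IsCompact K) (x : Fin n → ℝ) :
    {z | x + intVecHom n z ∈ K}.Finite := by
  refine (finite_preimage_intVec (hK.image (f := fun y => -x + y) (by fun_prop)).isBounded).subset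
    fun z hz => ⟨_, hz, ?_⟩
  simp [intVecHom]

/-- Every point has exactly one integer translate in the half-open unit cube, which has volume `1`.
-/
theorem quotientVolume_intVecHom_le_one {S : Set (Fin n → ℝ)} (hS : MeasurableSet S) :
    quotientVolume volume (intVecHom n) S ≤ 1 := by
  have hex : ∀ x : Fin n → ℝ, ∀ z, x + intVecHom n z ∈ Set.pi univ (fun _ => Ico (0 : ℝ) 1) ↔
      z = fun j => -⌊x j⌋ := by
    intro x z
    simp only [Set.mem_pi, mem_univ, true_implies, funext_iff]
    refine forall_congr' fun j => ?_
    have : (x + intVecHom n z) j = x j + z j := rfl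
    rw [this, mem_Ico, eq_neg_iff_add_eq_zero, add_comm (z j), ← sub_neg_eq_add ⌊x j⌋,
      sub_eq_zero, Int.floor_eq_iff]
    push_cast
    constructor <;> rintro ⟨h1, h2⟩ <;> constructor <;> linarith
  have hone : ∀ x, translateCount (intVecHom n) (Set.pi univ (fun _ => Ico (0 : ℝ) 1)) x = 1 := by
    intro x
    unfold translateCount
    rw [tsum_eq_single (fun j => -⌊x j⌋)
      (fun z hz => indicator_of_notMem (fun h => hz ((hex x z).1 h)) _),
      indicator_of_mem ((hex x _).2 rfl)]
  have hm : MeasurableSet (Set.pi univ (fun _ : Fin n => Ico (0 : ℝ) 1)) :=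
    MeasurableSet.univ_pi fun _ => measurableSet_Ico
  refine (quotientVolume_le volume (intVecHom n) hS hm (fun x => ?_) fun x _ => ?_).trans ?_
  · rw [hone]; exact ENNReal.one_lt_top
  · exact ⟨_, (hex x _).2 rfl⟩
  · rw [quotientVolume_eq_measure _ _ hm fun x _ => hone x, Real.volume_pi_Ico]
    simp

/-- The translates of a set `S` by integer vectors which meet `S` are determined by the integer
points of `S - S`. -/
theorem quotientVolume_subgroup {S : Set (Fin n → ℝ)} (H : AddSubgroup (Fin n → ℤ))
    (h : ∀ z : Fin n → ℤ, intVec z ∈ S - S → z ∈ H) :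
    quotientVolume volume ((intVecHom n).comp H.subtype) S =
      quotientVolume volume (intVecHom n) S := by
  refine lintegral_congr fun x => ?_
  unfold quotientWeight
  by_cases hx : x ∈ S
  · rw [indicator_of_mem hx, indicator_of_mem hx]
    congr 1
    unfold translateCount
    refine Eq.trans (tsum_subtype (H : Set (Fin n → ℤ))
      fun z => S.indicator (fun _ => (1 : ℝ≥0∞)) (x + intVecHom n z)) (tsum_congr fun z => ?_)
    by_cases hz : z ∈ H
    · rw [indicator_of_mem (show z ∈ (H : Set (Fin n → ℤ)) from hz)]
    · rw [indicator_of_notMem (show z ∉ (H : Set (Fin n → ℤ)) from hz), indicator_of_notMem]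
      intro hmem
      exact hz (h z ⟨_, hmem, x, hx, by simp [intVecHom]⟩)
  · rw [indicator_of_notMem hx, indicator_of_notMem hx]

variable {Z : Set (Fin n → ℝ)} {q : Fin n → ℤ} {l : List (Fin n → ℤ)}

theorem smul_sub_smul_eq (s : ℝ) : s • Z - s • Z = s • differenceBody Z := by
  ext x
  simp only [differenceBody, mem_sub, mem_smul_set]
  constructor
  · rintro ⟨_, ⟨a, ha, rfl⟩, _, ⟨b, hb, rfl⟩, rfl⟩
    exact ⟨a - b, ⟨a, ha, b, hb, rfl⟩, smul_sub s a b⟩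
  · rintro ⟨_, ⟨a, ha, b, hb, rfl⟩, rfl⟩
    exact ⟨_, ⟨a, ha, rfl⟩, _, ⟨b, hb, rfl⟩, (smul_sub s a b).symm⟩

theorem smul_differenceBody_mono (hZ : Z = {intVec q} + combos 0 1 (l.map intVec)) {r s : ℝ}
    (hr : 0 < r) (hrs : r ≤ s) : r • differenceBody Z ⊆ s • differenceBody Z := by
  have hconv : Convex ℝ (differenceBody Z) := (convex_zonotope hZ).sub (convex_zonotope hZ)
  have hs : 0 < s := hr.trans_le hrs
  rintro _ ⟨x, hx, rfl⟩
  refine ⟨(r / s) • x, hconv.smul_mem_of_zero_mem (zero_mem_differenceBody hZ) hx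
    ⟨by positivity, (div_le_one hs).2 hrs⟩, ?_⟩
  simp only [smul_smul, mul_div_cancel₀ _ hs.ne']

/-- Overlaps of `r • Z` and `s • Z` with their integer translates come from lattice points of `s •
DZ`, which span a space `L` of dimension at most `i`. Only translations in `L` matter, so the
directions complementary to `L` scale freely. -/
theorem quotientVolume_ratio (hZ : Z = {intVec q} + combos 0 1 (l.map intVec)) {r s : ℝ}
    (hr : 0 < r) (hrs : r ≤ s) {i : ℕ}
    (hi : affineDim ((s • differenceBody Z) ∩ intLattice n) ≤ i) :
    ENNReal.ofReal ((s / r) ^ (n - i)) * quotientVolume volume (intVecHom n) (r • Z) ≤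
      quotientVolume volume (intVecHom n) (s • Z) := by
  set L := Submodule.span ℝ ((s • differenceBody Z) ∩ intLattice n) with hL
  have hLi : finrank ℝ L ≤ i := (affineDim_smul_differenceBody hZ s).symm.trans_le hi
  let H : AddSubgroup (Fin n → ℤ) := L.toAddSubgroup.comap (intVecHom n)
  have hs : ∀ z : Fin n → ℤ, intVec z ∈ s • Z - s • Z → z ∈ H := by
    intro z hz
    rw [smul_sub_smul_eq] at hz
    exact Submodule.subset_span ⟨hz, z, rfl⟩
  have hr' : ∀ z : Fin n → ℤ, intVec z ∈ r • Z - r • Z → z ∈ H := by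
    intro z hz
    rw [smul_sub_smul_eq] at hz
    exact Submodule.subset_span ⟨smul_differenceBody_mono hZ hr hrs hz, z, rfl⟩
  have h1 : 1 ≤ s / r := (one_le_div hr).2 hrs
  rw [← quotientVolume_subgroup H hs, ← quotientVolume_subgroup H hr']
  have key := quotientVolume_smul volume L ((intVecHom n).comp H.subtype) (fun z => z.2)
    ((convex_zonotope hZ).smul r) ((isCompact_zonotope hZ).smul r) (fun K hK => ?_) h1
  · rw [smul_smul, div_mul_cancel₀ _ hr.ne', finrank_fin_fun] at key
    refine le_trans ?_ key
    gcongr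
  · have := (finite_intVec_add hK 0).preimage (f := ((↑) : H → Fin n → ℤ))
      Subtype.coe_injective.injOn
    simpa using this

theorem quotientVolume_small (hZ : Z = {intVec q} + combos 0 1 (l.map intVec)) {s : ℝ}
    (hi : affineDim ((s • differenceBody Z) ∩ intLattice n) = 0) :
    quotientVolume volume (intVecHom n) (s • Z) = volume (s • Z) := by
  rw [affineDim_smul_differenceBody hZ] at hi
  have hbot := Submodule.finrank_eq_zero.1 hi
  refine quotientVolume_eq_measure _ _ ((isCompact_zonotope hZ).smul s).measurableSet
    fun x hx => ?_
  unfold translateCount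
  rw [tsum_eq_single 0]
  · rw [map_zero, add_zero, indicator_of_mem hx]
  · intro z hz
    refine indicator_of_notMem (fun hmem => hz ?_) _
    have h1 : intVec z ∈ s • Z - s • Z := ⟨_, hmem, x, hx, by simp [intVecHom]⟩
    rw [smul_sub_smul_eq] at h1
    have h2 : intVec z ∈ Submodule.span ℝ ((s • differenceBody Z) ∩ intLattice n) :=
      Submodule.subset_span ⟨h1, z, rfl⟩
    rw [hbot, Submodule.mem_bot] at h2
    exact intVec_injective (h2.trans (map_zero (intVecHom n)).symm)

/-- If `DZ` has norm bound `R`, then `t • DZ` with `t < 1 / R` contains no nonzero integer vector.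
-/
theorem successiveMin_one_pos (hZ : Z = {intVec q} + combos 0 1 (l.map intVec))
    (hdim : affineDim Z = n) (hn : 1 ≤ n) : 0 < successiveMin (differenceBody Z) 1 := by
  have hb : Bornology.IsBounded (differenceBody Z) :=
    (isCompact_combos _).isBounded.subset (differenceBody_subset hZ)
  obtain ⟨R, hR0, hR⟩ := hb.exists_pos_norm_le
  refine (inv_pos.2 hR0).trans_le (le_csInf ⟨1, one_mem_successiveMin hZ hdim hn⟩ ?_)
  rintro t ⟨ht, h⟩
  by_contra! hlt
  rw [affineDim_smul_differenceBody hZ] at h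
  have : Submodule.span ℝ ((t • differenceBody Z) ∩ intLattice n) = ⊥ := by
    rw [Submodule.span_eq_bot]
    rintro _ ⟨⟨x, hx, hxz⟩, z, rfl⟩
    have hz : ∀ j, z j = 0 := by
      intro j
      have h1 : |(z j : ℝ)| ≤ t * R := by
        have h2 := norm_le_pi_norm (t • x) j
        have h3 : (t • x) j = z j := congrFun hxz j
        rw [h3, norm_smul, Real.norm_of_nonneg ht.le] at h2
        exact h2.trans (mul_le_mul_of_nonneg_left (hR x hx) ht.le)
      have h4 : t * R < 1 := by rwa [← lt_div_iff₀ hR0, one_div]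
      have h5 : |(z j : ℝ)| < 1 := h1.trans_lt h4
      rw [← Int.abs_lt_one_iff]
      exact_mod_cast h5
    ext j
    simp [hz]
  rw [this, finrank_bot] at h
  omega

/-- **Minkowski's second theorem** for lattice zonotopes. -/
theorem vol_mul_prod_successiveMin_le (hZ : Z = {intVec q} + combos 0 1 (l.map intVec))
    (hdim : affineDim Z = n) :
    vol Z * ∏ j ∈ Finset.Icc 1 n, successiveMin (differenceBody Z) j ≤ 1 := by
  rcases Nat.eq_zero_or_pos n with rfl | hn
  · rw [vol_eq hZ, indexSum_zero]
    simp
  set lam := successiveMin (differenceBody Z) with hlam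
  have hpos : ∀ j, 1 ≤ j → j ≤ n → 0 < lam j := fun j h1 hj =>
    (successiveMin_one_pos hZ hdim hn).trans_le (successiveMin_mono hZ hdim h1 hj)
  set T : ℝ → ℝ := fun s => (quotientVolume volume (intVecHom n) (s • Z)).toReal with hT
  have hle1 : ∀ s : ℝ, quotientVolume volume (intVecHom n) (s • Z) ≤ 1 := fun s =>
    quotientVolume_intVecHom_le_one ((isCompact_zonotope hZ).smul s).measurableSet
  have hT1 : ∀ s : ℝ, T s ≤ 1 := fun s => ENNReal.toReal_mono ENNReal.one_ne_top (hle1 s)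
  have hstep : ∀ r s i, 0 < r → r ≤ s →
      affineDim ((s • differenceBody Z) ∩ intLattice n) ≤ i → (s / r) ^ (n - i) * T r ≤ T s := by
    intro r s i hr hrs hi
    have hs := hr.trans_le hrs
    have := ENNReal.toReal_mono ((hle1 s).trans_lt ENNReal.one_lt_top).ne
      (quotientVolume_ratio hZ hr hrs hi)
    rwa [ENNReal.toReal_mul, ENNReal.toReal_ofReal (by positivity)] at this
  -- The factor `θ` puts the radii strictly below the minima, where the dimension bounds hold; `θ →
  -- 1` at the end.
  have hθ : ∀ θ ∈ Ioo (0 : ℝ) 1, vol Z * ∏ j ∈ Finset.Icc 1 n, (θ * lam j) ≤ 1 := by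
    rintro θ ⟨hθ0, hθ1⟩
    have hlt : ∀ j, 1 ≤ j → j ≤ n →
        affineDim (((θ * lam j) • differenceBody Z) ∩ intLattice n) < j := fun j h1 hj =>
      affineDim_lt_of_lt_successiveMin (mul_pos hθ0 (hpos j h1 hj))
        (mul_lt_of_lt_one_left (hpos j h1 hj) hθ1)
    have hind : ∀ j, 1 ≤ j → j ≤ n → vol Z * (∏ k ∈ Finset.Icc 1 j, (θ * lam k)) *
        (θ * lam j) ^ (n - j) ≤ T (θ * lam j) := by
      intro j hj
      induction j, hj using Nat.le_induction with
      | base =>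
        intro h1n
        have h0 : affineDim (((θ * lam 1) • differenceBody Z) ∩ intLattice n) = 0 := by
          have := hlt 1 le_rfl h1n
          omega
        have hp := mul_pos hθ0 (hpos 1 le_rfl h1n)
        simp only [hT]
        rw [quotientVolume_small hZ h0, Measure.addHaar_smul_of_nonneg _ hp.le, finrank_fin_fun,
          ENNReal.toReal_mul, ENNReal.toReal_ofReal (by positivity), Finset.Icc_self,
          Finset.prod_singleton, mul_assoc, ← pow_succ', Nat.sub_add_cancel h1n, mul_comm]
        rfl
      | succ j hj ih =>
        intro hjn
        have hpj := mul_pos hθ0 (hpos j hj (by omega))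
        have hpj' := mul_pos hθ0 (hpos (j + 1) (by omega) hjn)
        have hmono : θ * lam j ≤ θ * lam (j + 1) :=
          mul_le_mul_of_nonneg_left (successiveMin_mono hZ hdim (by omega) hjn) hθ0.le
        -- Going from `θ λ_j` to `θ λ_(j+1)` multiplies the torus volume by at least the `(n -
        -- j)`-th power of the ratio; one factor `θ λ_(j+1)` joins the product and `n - j - 1`
        -- remain.
        have h1 := hstep _ _ j hpj hmono (by have := hlt (j + 1) (by omega) hjn; omega)
        refine le_trans ?_ h1
        refine le_trans (le_of_eq ?_) (mul_le_mul_of_nonneg_left (ih (by omega)) (by positivity))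
        rw [Finset.prod_Icc_succ_top (by omega), div_pow,
          show n - j = n - (j + 1) + 1 by omega]
        have := (pow_pos hpj (n - (j + 1) + 1)).ne'
        field_simp
        ring
    have := (hind n hn le_rfl).trans (hT1 _)
    simpa using this
  have hlim : Filter.Tendsto (fun θ : ℝ => vol Z * ∏ j ∈ Finset.Icc 1 n, (θ * lam j))
      (nhdsWithin 1 (Iio 1)) (nhds (vol Z * ∏ j ∈ Finset.Icc 1 n, (1 * lam j))) := by
    refine Filter.Tendsto.mono_left ?_ nhdsWithin_le_nhds
    refine Continuous.tendsto
      (f := fun θ : ℝ => vol Z * ∏ j ∈ Finset.Icc 1 n, (θ * lam j)) ?_ 1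
    fun_prop
  simp only [one_mul] at hlim
  refine le_of_tendsto hlim ?_
  filter_upwards [Ioo_mem_nhdsLT (zero_lt_one (α := ℝ))] with θ h
  exact hθ θ h

end Minkowski

end LatticeZonotope

end

/-! ### The two coefficient inequalities -/

theorem mainTheorem2 (n : ℕ) (Z : Set (Fin n → ℝ))
    (hZ : LatticeZonotope.IsLatticeZonotope Z)
    (hdim : LatticeZonotope.affineDim Z = n) :
    (∀ k : ℕ, (LatticeZonotope.latticePointCount ((k : ℝ) • Z) : ℝ) =
      ∑ i ∈ Finset.range (n + 1), LatticeZonotope.ehrhartCoeff Z i * (k : ℝ) ^ i) ∧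
    ∀ i : ℕ, i ≤ n →
      LatticeZonotope.ehrhartCoeff Z i / LatticeZonotope.vol Z ≤
          ((n.factorial : ℝ) / (i.factorial : ℝ)) *
            ∏ j ∈ Finset.Icc (i + 1) n,
              LatticeZonotope.successiveMin (LatticeZonotope.differenceBody Z) j ∧
      LatticeZonotope.ehrhartCoeff Z i ≤
          ((n.factorial : ℝ) / (i.factorial : ℝ)) * LatticeZonotope.sigma Z i := by
  open LatticeZonotope in
  obtain ⟨q, l, hZl⟩ := hZ.exists_list
  refine ⟨fun k => ?_, fun i hi => ?_⟩
  · rw [latticePointCount_smul hZl, Nat.cast_sum]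
    refine Finset.sum_congr rfl fun i hi => ?_
    rw [ehrhartCoeff_eq hZl (Nat.lt_succ_iff.1 (Finset.mem_range.1 hi))]
    push_cast
    rfl
  have hle := indexSum_le hZl hdim hi
  have hmink := vol_mul_prod_successiveMin_le hZl hdim
  rw [ehrhartCoeff_eq hZl hi]
  rw [← vol_eq hZl] at hle
  have hvol : 0 ≤ vol Z := ENNReal.toReal_nonneg
  have hfac : (0 : ℝ) ≤ n.factorial / i.factorial := by positivity
  have hprod : 0 ≤ ∏ j ∈ Finset.Icc (i + 1) n, successiveMin (differenceBody Z) j :=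
    Finset.prod_nonneg fun j _ => successiveMin_nonneg _ _
  -- Nonnegativity of the volume suffices here, as division by zero gives `0`.
  refine ⟨div_le_of_le_mul₀ hvol (mul_nonneg hfac hprod) (hle.trans_eq (by ring)), ?_⟩
  have hpos : ∀ j ∈ Finset.Icc 1 n, 0 < successiveMin (differenceBody Z) j := by
    intro j hj
    rw [Finset.mem_Icc] at hj
    exact (successiveMin_one_pos hZl hdim (by omega)).trans_le
      (successiveMin_mono hZl hdim hj.1 hj.2)
  have hpos' : 0 < ∏ j ∈ Finset.Icc 1 i, successiveMin (differenceBody Z) j :=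
    Finset.prod_pos fun j hj => hpos j (Finset.Icc_subset_Icc_right hi hj)
  have hsplit : (∏ j ∈ Finset.Icc 1 i, successiveMin (differenceBody Z) j) *
      ∏ j ∈ Finset.Icc (i + 1) n, successiveMin (differenceBody Z) j =
        ∏ j ∈ Finset.Icc 1 n, successiveMin (differenceBody Z) j := by
    rw [← Finset.prod_union]
    · congr 1
      ext j
      simp only [Finset.mem_union, Finset.mem_Icc]
      omega
    · rw [Finset.disjoint_left]
      intro j
      simp only [Finset.mem_Icc]
      omega
  have h1 : vol Z * ∏ j ∈ Finset.Icc (i + 1) n, successiveMin (differenceBody Z) j ≤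
      ∏ j ∈ Finset.Icc 1 i, 1 / successiveMin (differenceBody Z) j := by
    rw [Finset.prod_div_distrib, Finset.prod_const_one, le_div_iff₀ hpos', mul_assoc,
      mul_comm (∏ j ∈ Finset.Icc (i + 1) n, _), hsplit]
    exact hmink
  -- Only the term `I = {1, …, i}` of the elementary symmetric sum is kept.
  have h2 : ∏ j ∈ Finset.Icc 1 i, 1 / successiveMin (differenceBody Z) j ≤ sigma Z i := by
    refine Finset.single_le_sum
      (f := fun I => ∏ j ∈ I, 1 / successiveMin (differenceBody Z) j) (fun I hI => ?_) ?_
    · exact Finset.prod_nonneg fun j _ => one_div_nonneg.2 (successiveMin_nonneg _ _)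
    · rw [Finset.mem_powersetCard]
      exact ⟨Finset.Icc_subset_Icc_right hi, by simp⟩
  calc (indexSum l i : ℝ)
      ≤ (n.factorial / i.factorial : ℝ) *
          (vol Z * ∏ j ∈ Finset.Icc (i + 1) n, successiveMin (differenceBody Z) j) :=
        hle.trans_eq (by ring)
    _ ≤ (n.factorial / i.factorial : ℝ) * sigma Z i :=
        mul_le_mul_of_nonneg_left (h1.trans h2) hfac
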